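/- **Definitions.** Fix $0<\alpha<\tfrac12$. Let $H_\alpha$ be the weighted Bergman space of entire functions $f$ with $\int_{\mathbb C}|f(z)|^2e^{-2|z|^\alpha}\,dA(z)<\infty$, with inner product $(f,g)=\int_{\mathbb C}\overline{f}\,g\,e^{-2|z|^\alpha}\,dA$, and let $E\subset H_\alpha$ be the subspace of constant functions. For a bounded family $Z=(z_i)$ of complex numbers let $D_Z=\bigoplus_i\left(\tfrac{d}{dz}+z_iI\right)\big|_E$, acting on the Hilbert space direct sum $\bigoplus_iE$. For an entire function $f$ with $f(0)\neq0$ let $D_f=D_Z$, where $Z$ is the family of the reciprocals of the zeros of $f$, repeated according to multiplicity. Let $J_p$ be the ideal of compact operators whose singular values are $p$-summable. For $B\in J_1$ let $\det(I+B)=\prod_k(1+\lambda_k(B))$, the product running over the nonzero eigenvalues of $B$, repeated according to algebraic multiplicity. For $A\in J_n$ let $\det_n(I+A)=\det(I+R_n(A))$, where $R_n(A)=(I+A)\exp\left(\sum_{j=1}^{n-1}(-1)^jj^{-1}A^j\right)-I$. Let $\phi(s)=1-s$, let $\xi(s)=\tfrac12\pi^{-s/2}s(s-1)\Gamma(s/2)\zeta(s)$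 (continued to an entire function), and let $D_\Gamma:=D_g$ for the entire function $g(z)=1/(z\Gamma(z))$, $g(0)=1$; thus the eigenvalues of $D_\Gamma$ are the reciprocals $-\tfrac1n$, $n\ge1$, of the poles of $z\Gamma(z)$. **Theorem.** The operators $D_\Gamma$ and $D_\xi$ belong to $J_2$, the operator $D_\phi$ belongs to $J_1$, and for all $s\in\mathbb C$ with $s\neq1$ $$\zeta(s)=-\frac{e^{(\log(2\pi)-1)s}}{2}\cdot\frac{\det_2\!\left(I-\tfrac s2D_\Gamma\right)\,\det_2\!\left(I-sD_\xi\right)}{\det_1\!\left(I-sD_\phi\right)}.$$ The three determinants are entire functions of $s$, and they account for the zeros and the pole of $\zeta$ as follows. 1. $\det_2(I-\tfrac s2D_\Gamma)$ vanishes exactly at the trivial zeros $s=-2,-4,-6,\dots$ of $\zeta$, with the same orders as $\zeta$. 2. $\det_2(I-sD_\xi)$ vanishes exactly at the critical zeros of $\zeta$ (those with $0<\operatorname{Re}s<1$), with the same orders as $\zeta$. 3. $\det_1(I-sD_\phi)$ vanishes exactly at $s=1$, to first order, and $\zeta$ has a simple pole there. -/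

import Mathlib

open MeasureTheory

/-! ### Trace ideals and regularized determinants -/

/-- `A` belongs to the trace ideal `J_p`: it is compact and has a singular value expansion
`A x = ∑ μ_i ⟨ψ_i, x⟩ φ_i` with `ψ`, `φ` orthonormal, singular values `μ_i > 0`, and
`∑ μ_i ^ p < ∞`. -/
def MemTraceIdeal {H : Type*} [NormedAddCommGroup H] [InnerProductSpace ℂ H]
    (p : ℕ) (A : H →L[ℂ] H) : Prop :=
  IsCompactOperator A ∧
  ∃ (ι : Type) (ψ φ : ι → H) (μ : ι → ℝ),
    Orthonormal ℂ ψ ∧ Orthonormal ℂ φ ∧ (∀ i, 0 < μ i) ∧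
    (∀ x, HasSum (fun i => ((μ i : ℂ) * inner ℂ (ψ i) x) • φ i) (A x)) ∧
    Summable fun i => μ i ^ p

/-- The algebraic multiplicity of `l` as an eigenvalue of `B` (it is `0` if `l` is not an
eigenvalue): the dimension of the generalized eigenspace. -/
noncomputable def algMultiplicity {H : Type*} [NormedAddCommGroup H] [InnerProductSpace ℂ H]
    (B : H →L[ℂ] H) (l : ℂ) : ℕ :=
  Module.finrank ℂ (Module.End.maxGenEigenspace (B : Module.End ℂ H) l)

/-- The Fredholm determinant `det (I + B)` of a trace class operator `B`: the product of `1 + l`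
over the nonzero eigenvalues `l` of `B`, repeated according to algebraic multiplicity. -/
noncomputable def fredholmDet {H : Type*} [NormedAddCommGroup H] [InnerProductSpace ℂ H]
    (B : H →L[ℂ] H) : ℂ :=
  ∏' l : {l : ℂ // l ≠ 0}, (1 + (l : ℂ)) ^ algMultiplicity B l

/-- `R_n(A) = (I + A) exp (∑_{j=1}^{n-1} (-1)^j j⁻¹ A^j) - I`. -/
noncomputable def regularizer {H : Type*} [NormedAddCommGroup H] [InnerProductSpace ℂ H]
    (n : ℕ) (A : H →L[ℂ] H) : H →L[ℂ] H :=
  (1 + A) * NormedSpace.exp (∑ j ∈ Finset.Ico 1 n, ((-1 : ℂ) ^ j * (j : ℂ)⁻¹) • A ^ j) - 1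

/-- The regularized determinant `det_n (I + A) = det (I + R_n(A))` of `A ∈ J_n`. -/
noncomputable def regDet {H : Type*} [NormedAddCommGroup H] [InnerProductSpace ℂ H]
    (n : ℕ) (A : H →L[ℂ] H) : ℂ :=
  fredholmDet (regularizer n A)

/-! ### The weighted Bergman space `H_α` with weight `w(z) = exp (-|z|^α)` -/

/-- Entire functions `f` with `f w ∈ L²(ℂ)`, where `w(z) = exp (-|z|^α)`. -/
def bergmanSubmodule (α : ℝ) : Submodule ℂ (ℂ → ℂ) where
  carrier := {f | Differentiable ℂ f ∧
    MemLp (fun z => f z * (Real.exp (-‖z‖ ^ α) : ℂ)) 2 volume}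
  zero_mem' := ⟨differentiable_const 0, by simp⟩
  add_mem' := by
    rintro f g ⟨hf, hf'⟩ ⟨hg, hg'⟩
    refine ⟨hf.add hg, ?_⟩
    convert hf'.add hg' using 1
    ext z
    simp [add_mul]
  smul_mem' := by
    rintro c f ⟨hf, hf'⟩
    refine ⟨hf.const_smul c, ?_⟩
    convert hf'.const_smul c using 1
    ext z
    simp [mul_assoc]

/-- The weighted Bergman space `H_α`. It is a type synonym, so that it does not inherit the
topology of pointwise convergence. -/
def BergmanSpace (α : ℝ) : Type := bergmanSubmodule α

noncomputable instance (α : ℝ) : AddCommGroup (BergmanSpace α) :=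
  inferInstanceAs (AddCommGroup (bergmanSubmodule α))

noncomputable instance (α : ℝ) : Module ℂ (BergmanSpace α) :=
  inferInstanceAs (Module ℂ (bergmanSubmodule α))

instance (α : ℝ) : CoeFun (BergmanSpace α) (fun _ => ℂ → ℂ) := ⟨fun f => f.1⟩

theorem BergmanSpace.add_apply {α : ℝ} (f g : BergmanSpace α) (z : ℂ) :
    (f + g) z = f z + g z := rfl

theorem BergmanSpace.smul_apply {α : ℝ} (c : ℂ) (f : BergmanSpace α) (z : ℂ) :
    (c • f) z = c * f z := rfl

theorem BergmanSpace.integrable_inner {α : ℝ} (f g : BergmanSpace α) :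
    Integrable (fun z : ℂ => starRingEnd ℂ (f z) * g z * (Real.exp (-2 * ‖z‖ ^ α) : ℂ)) := by
  have h := f.2.2.star.integrable_mul g.2.2
  refine h.congr (Filter.Eventually.of_forall fun z => ?_)
  have e : (Real.exp (-2 * ‖z‖ ^ α) : ℂ)
      = (Real.exp (-‖z‖ ^ α) : ℂ) * (Real.exp (-‖z‖ ^ α) : ℂ) := by
    rw [← Complex.ofReal_mul, ← Real.exp_add]
    congr 2
    ring
  simp only [Pi.mul_apply, Pi.star_apply, star_mul', e]
  rw [← starRingEnd_apply, ← starRingEnd_apply, Complex.conj_ofReal]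
  ring

theorem BergmanSpace.inner_self_eq {α : ℝ} (f : BergmanSpace α) :
    ∫ z : ℂ, starRingEnd ℂ (f z) * f z * (Real.exp (-2 * ‖z‖ ^ α) : ℂ)
      = ((∫ z : ℂ, ‖f z‖ ^ 2 * Real.exp (-2 * ‖z‖ ^ α) : ℝ) : ℂ) := by
  rw [← integral_complex_ofReal]
  congr 1
  ext z
  rw [mul_comm (starRingEnd ℂ (f z)), Complex.mul_conj, Complex.normSq_eq_norm_sq]
  push_cast
  rfl

/-- The inner product `(f, g) = ∫ conj (f z) g(z) exp (-2|z|^α) dz` of `H_α`. -/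
@[reducible] noncomputable def bergmanCore (α : ℝ) : InnerProductSpace.Core ℂ (BergmanSpace α) where
  inner f g := ∫ z : ℂ, starRingEnd ℂ (f z) * g z * (Real.exp (-2 * ‖z‖ ^ α) : ℂ)
  conj_inner_symm f g := by
    rw [← integral_conj]
    congr 1
    ext z
    simp only [map_mul, Complex.conj_conj, Complex.conj_ofReal]
    ring
  re_inner_nonneg f := by
    rw [BergmanSpace.inner_self_eq]
    simp only [RCLike.re_to_complex, Complex.ofReal_re]
    exact integral_nonneg fun z => by positivity
  add_left f g h := by
    rw [← integral_add (BergmanSpace.integrable_inner f h) (BergmanSpace.integrable_inner g h)]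
    congr 1
    ext z
    rw [BergmanSpace.add_apply, map_add]
    ring
  smul_left f g c := by
    rw [← integral_const_mul]
    congr 1
    ext z
    rw [BergmanSpace.smul_apply, map_mul]
    ring
  definite f hf := by
    change (∫ z : ℂ, starRingEnd ℂ (f z) * f z * (Real.exp (-2 * ‖z‖ ^ α) : ℂ)) = 0 at hf
    have hint := (BergmanSpace.integrable_inner f f).norm
    have hf2 := hf
    rw [BergmanSpace.inner_self_eq, Complex.ofReal_eq_zero] at hf2
    have hint' : Integrable (fun z : ℂ => ‖f z‖ ^ 2 * Real.exp (-2 * ‖z‖ ^ α)) := by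
      refine hint.congr (Filter.Eventually.of_forall fun z => ?_)
      simp only [norm_mul, RCLike.norm_conj, Complex.norm_real, Real.norm_eq_abs, Real.abs_exp]
      ring
    rw [integral_eq_zero_iff_of_nonneg (fun z => by positivity) hint'] at hf2
    have hae : (f : ℂ → ℂ) =ᵐ[volume] fun _ => (0 : ℂ) := by
      filter_upwards [hf2] with z hz
      have := (mul_eq_zero.mp hz).resolve_right (Real.exp_pos _).ne'
      simpa using this
    have hc : Continuous (f : ℂ → ℂ) := f.2.1.continuous
    exact Subtype.ext (MeasureTheory.Measure.eq_of_ae_eq hae hc continuous_const)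

noncomputable instance (α : ℝ) : NormedAddCommGroup (BergmanSpace α) :=
  (bergmanCore α).toNormedAddCommGroup

noncomputable instance (α : ℝ) : InnerProductSpace ℂ (BergmanSpace α) :=
  InnerProductSpace.ofCore (bergmanCore α).toCore

/-! ### The operator `D_Z` -/

/-- The subspace `E` of constant functions in `H_α`. -/
def constFunctions (α : ℝ) : Submodule ℂ (BergmanSpace α) where
  carrier := {f | ∃ c : ℂ, ∀ z, f z = c}
  zero_mem' := ⟨0, fun _ => rfl⟩
  add_mem' := by
    rintro f g ⟨c, hc⟩ ⟨d, hd⟩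
    exact ⟨c + d, fun z => by rw [BergmanSpace.add_apply, hc, hd]⟩
  smul_mem' := by
    rintro a f ⟨c, hc⟩
    exact ⟨a * c, fun z => by rw [BergmanSpace.smul_apply, hc]⟩

/-- On constant functions `f' + τ f = τ f`. -/
theorem deriv_add_smul_const {α : ℝ} (τ : ℂ) (f : constFunctions α) :
    (fun z => deriv (f.1 : ℂ → ℂ) z + τ * f.1 z) = ((τ • f : constFunctions α).1 : ℂ → ℂ) := by
  obtain ⟨c, hc⟩ := f.2
  have h : (f.1 : ℂ → ℂ) = fun _ => c := funext hc
  funext z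
  change _ = τ * f.1 z
  rw [h]
  simp

/-- The operator `D_τ = D + τ I`, with `D = d/dz`, restricted to the space `E` of constant
functions. -/
noncomputable def translatedDeriv (α : ℝ) (τ : ℂ) :
    constFunctions α →ₗ[ℂ] constFunctions α where
  toFun f := ⟨⟨fun z => deriv (f.1 : ℂ → ℂ) z + τ * f.1 z, by
      rw [deriv_add_smul_const]; exact (τ • f : constFunctions α).1.2⟩, by
    obtain ⟨c, hc⟩ := (τ • f : constFunctions α).2
    exact ⟨c, fun z => (congrFun (deriv_add_smul_const τ f) z).trans (hc z)⟩⟩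
  map_add' f g := by
    apply Subtype.ext
    apply Subtype.ext
    change (fun z => deriv ((f + g : constFunctions α).1 : ℂ → ℂ) z
      + τ * (f + g : constFunctions α).1 z) = _
    rw [deriv_add_smul_const, smul_add]
    exact congrArg₂ (· + ·) (deriv_add_smul_const τ f).symm (deriv_add_smul_const τ g).symm
  map_smul' c f := by
    apply Subtype.ext
    apply Subtype.ext
    change (fun z => deriv ((c • f : constFunctions α).1 : ℂ → ℂ) z
      + τ * (c • f : constFunctions α).1 z) = _
    rw [deriv_add_smul_const, smul_comm]
    exact congrArg (c • ·) (deriv_add_smul_const τ f).symm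

theorem translatedDeriv_apply {α : ℝ} (τ : ℂ) (f : constFunctions α) :
    translatedDeriv α τ f = τ • f :=
  Subtype.ext (Subtype.ext (deriv_add_smul_const τ f))

/-- The Hilbert space direct sum `E_Z = ⨁ E` of copies of `E`. -/
abbrev ConstSum (α : ℝ) (ι : Type) : Type := lp (fun _ : ι => constFunctions α) 2

/-- The operator `D_Z = ⨁ D_{z_i}` on `E_Z`, for a bounded family `Z = (z_i)`. -/
noncomputable def directSumOp (α : ℝ) {ι : Type} (z : ι → ℂ)
    (hz : BddAbove (Set.range fun i => ‖z i‖)) : ConstSum α ι →L[ℂ] ConstSum α ι :=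
  LinearMap.mkContinuousOfExistsBound
    { toFun := fun x => ⟨fun i => translatedDeriv α (z i) (x i), by
        obtain ⟨C, hC⟩ := hz
        refine ((lp.memℓp x).const_smul (C : ℂ)).mono' fun i => ?_
        have hC' : ‖z i‖ ≤ C := hC ⟨i, rfl⟩
        rw [translatedDeriv_apply, norm_smul, Pi.smul_apply, norm_smul, Complex.norm_real]
        exact mul_le_mul_of_nonneg_right (hC'.trans (le_abs_self C)) (norm_nonneg _)⟩
      map_add' := fun x y => by
        ext1
        funext i
        exact map_add (translatedDeriv α (z i)) (x i) (y i)
      map_smul' := fun c x => by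
        ext1
        funext i
        exact map_smul (translatedDeriv α (z i)) c (x i) }
    (by
      obtain ⟨C, hC⟩ := hz
      refine ⟨|C|, fun x => ?_⟩
      have h : ‖(C : ℂ) • x‖ = |C| * ‖x‖ := by
        rw [norm_smul, Complex.norm_real, Real.norm_eq_abs]
      rw [← h]
      refine lp.norm_mono (by norm_num) fun i => ?_
      have hC' : ‖z i‖ ≤ C := hC ⟨i, rfl⟩
      change ‖translatedDeriv α (z i) (x i)‖ ≤ ‖(C : ℂ) • x i‖
      rw [translatedDeriv_apply, norm_smul, norm_smul, Complex.norm_real]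
      exact mul_le_mul_of_nonneg_right (hC'.trans (le_abs_self C)) (norm_nonneg _))

/-- The zeros of `f`, each one repeated according to its multiplicity. -/
abbrev ZeroIndex (f : ℂ → ℂ) : Type :=
  Σ a : {a : ℂ // f a = 0}, Fin (analyticOrderNatAt f a)

theorem bddAbove_inv_zeros {f : ℂ → ℂ} (hf : Differentiable ℂ f) (h0 : f 0 ≠ 0) :
    BddAbove (Set.range fun i : ZeroIndex f => ‖((i.1 : ℂ))⁻¹‖) := by
  obtain ⟨ε, hε, hball⟩ := Metric.eventually_nhds_iff.mp
    (hf.continuous.continuousAt.eventually_ne h0)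
  refine ⟨ε⁻¹, ?_⟩
  rintro _ ⟨⟨⟨a, ha⟩, k⟩, rfl⟩
  have h : ε ≤ ‖a‖ := by
    by_contra hlt
    exact hball (by simpa using not_le.mp hlt) ha
  simpa using inv_anti₀ hε h

/-- The operator `D_f` of an entire function `f` with `f(0) ≠ 0`: it is `D_Z` for the family `Z`
of the reciprocals of the zeros of `f`, counted with multiplicity. -/
noncomputable def entireOp (α : ℝ) (f : ℂ → ℂ) (hf : Differentiable ℂ f) (h0 : f 0 ≠ 0) :
    ConstSum α (ZeroIndex f) →L[ℂ] ConstSum α (ZeroIndex f) :=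
  directSumOp α (fun i => ((i.1 : ℂ))⁻¹) (bddAbove_inv_zeros hf h0)

/-! ### The three functions -/

/-- The entire function `1 / (z Γ(z)) = 1 / Γ(z + 1)`. -/
noncomputable def recipGamma (z : ℂ) : ℂ := (Complex.Gamma (z + 1))⁻¹

theorem recipGamma_eq {z : ℂ} (hz : z ≠ 0) : recipGamma z = 1 / (z * Complex.Gamma z) := by
  rw [recipGamma, Complex.Gamma_add_one z hz, one_div]

theorem differentiable_recipGamma : Differentiable ℂ recipGamma :=
  Complex.differentiable_one_div_Gamma.comp (differentiable_id.add_const 1)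

theorem recipGamma_zero_ne : recipGamma 0 ≠ 0 := by simp [recipGamma]

/-- The completed zeta function `ξ(s) = (1/2) π^(-s/2) s (s - 1) Γ(s/2) ζ(s)` as an entire function,
written through the entire function `Λ₀(s) = π^(-s/2) Γ(s/2) ζ(s) + 1/s + 1/(1 - s)`. -/
noncomputable def xiFunction (s : ℂ) : ℂ :=
  (s * (s - 1) * completedRiemannZeta₀ s + 1) / 2

theorem xiFunction_eq {s : ℂ} (h1 : s ≠ 1) (hs : ∀ n : ℕ, s ≠ -2 * n) :
    xiFunction s = 1 / 2 * (Real.pi : ℂ) ^ (-s / 2) * s * (s - 1) * Complex.Gamma (s / 2)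
      * riemannZeta s := by
  have h0 : s ≠ 0 := by simpa using hs 0
  have h1' : 1 - s ≠ 0 := sub_ne_zero.mpr (Ne.symm h1)
  have hG : Complex.Gamma (s / 2) ≠ 0 := Complex.Gamma_ne_zero fun m hm => hs m (by
    linear_combination 2 * hm)
  have hpi : (Real.pi : ℂ) ^ (-s / 2) ≠ 0 := by
    simp [Complex.cpow_eq_zero_iff, Real.pi_ne_zero]
  have hz := riemannZeta_def_of_ne_zero h0
  rw [completedRiemannZeta_eq, Complex.Gammaℝ_def] at hz
  rw [hz, xiFunction]
  field_simp
  ring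

theorem differentiable_xiFunction : Differentiable ℂ xiFunction :=
  (((differentiable_id.mul (differentiable_id.sub_const 1)).mul
    differentiable_completedZeta₀).add_const 1).div_const 2

theorem xiFunction_zero_ne : xiFunction 0 ≠ 0 := by simp [xiFunction]

/-- The polynomial `φ(s) = 1 - s`. -/
def phiFunction (s : ℂ) : ℂ := 1 - s

theorem differentiable_phiFunction : Differentiable ℂ phiFunction :=
  differentiable_id.const_sub 1

theorem phiFunction_zero_ne : phiFunction 0 ≠ 0 := by simp [phiFunction]

/-- The operator attached to the Gamma function: `D_Z`, with `Z` the reciprocals of the poles of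
`z Γ(z)`, that is of the zeros of `1 / (z Γ(z))`. -/
noncomputable def gammaOp (α : ℝ) :
    ConstSum α (ZeroIndex recipGamma) →L[ℂ] ConstSum α (ZeroIndex recipGamma) :=
  entireOp α recipGamma differentiable_recipGamma recipGamma_zero_ne

/-- The operator `D_ξ`. -/
noncomputable def xiOp (α : ℝ) :
    ConstSum α (ZeroIndex xiFunction) →L[ℂ] ConstSum α (ZeroIndex xiFunction) :=
  entireOp α xiFunction differentiable_xiFunction xiFunction_zero_ne

/-- The operator `D_φ`. -/
noncomputable def phiOp (α : ℝ) :
    ConstSum α (ZeroIndex phiFunction) →L[ℂ] ConstSum α (ZeroIndex phiFunction) :=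
  entireOp α phiFunction differentiable_phiFunction phiFunction_zero_ne

/-! ### The constant functions -/

/-! On constants `d/dz` vanishes, and `E` is a line because the weight is integrable. So `D_Z` is
the diagonal operator with entries `z_i` on an `ℓ²` sum of lines. Its singular values are `|z_i|`,
and `R_n` of it is again diagonal. Hence `J_p` membership is `p`-summability of the reciprocal
zeros, `det_1(I - s D_f) = ∏ (1 - s/a)` and `det_2(I - s D_f) = ∏ (1 - s/a) exp(s/a)` over the zeros
`a` of `f` (`IsDiagonal.fredholmDet_eq`, `regDet_two_entireOp`). The theorem thus becomes a product
formula for `ζ`.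

By `riemannZeta_eq_xiFunction`, `ζ(s) = -ξ(s) π^(s/2) / (Γ(s/2 + 1) (1 - s))`. The Weierstrass
product of `1/Γ(s/2 + 1)` carries the exponential `exp(γ s/2)`. Since `|ξ(s)| ≤ exp(C (1 +
|s|)^(3/2))`, Hadamard's theorem in order below two (`exists_eq_exp_mul_canonicalProduct`) makes `ξ`
a genus-one product times `exp(B s)/2`. A genus-one product has derivative zero at `0`, so `B =
ξ'(0)/ξ(0) = -Λ₀(0) = (log 4π - γ)/2 - 1`. The two occurrences of `γ` cancel, and with `π^(s/2)` the
total exponent is `(log 2π - 1) s`.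

For the zeros, `ζ ≠ 0` on `Re s ≥ 1` and `ξ(1 - s) = ξ(s)` confine those of `ξ` to the critical
strip, away from the trivial zeros. At each zero in question the other factors are analytic and
nonzero, so the orders agree. -/

theorem integrable_exp_neg_norm_rpow {α : ℝ} (hα : 0 < α) :
    Integrable (fun z : ℂ => Real.exp (-2 * ‖z‖ ^ α)) := by
  have hd : (Module.finrank ℝ ℂ : ℝ) < 3 := by
    rw [Complex.finrank_real_complex]; norm_num
  have hint := integrable_one_add_norm (E := ℂ) (μ := volume) hd
  have hcont : Continuous fun z : ℂ => Real.exp (-2 * ‖z‖ ^ α) := by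
    have : Continuous fun z : ℂ => ‖z‖ ^ α :=
      continuous_norm.rpow_const fun _ => Or.inr hα.le
    fun_prop
  -- The exponent `3 / α` turns `x = 2 |z|^α` into a multiple of `|z|^3`; decay of order three is
  -- integrable on the plane.
  have ht : Filter.Tendsto (fun x : ℝ => x ^ (3 / α) * Real.exp (-(1 : ℝ) * x)) Filter.atTop
      (nhds 0) := tendsto_rpow_mul_exp_neg_mul_atTop_nhds_zero _ _ one_pos
  have h1 : Filter.Tendsto (fun z : ℂ => 2 * ‖z‖ ^ α) (Filter.cocompact ℂ) Filter.atTop :=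
    ((tendsto_rpow_atTop hα).comp tendsto_norm_cocompact_atTop).const_mul_atTop two_pos
  have h2 := (ht.comp h1).eventually (gt_mem_nhds (one_pos : (0 : ℝ) < 1))
  have h3 := tendsto_norm_cocompact_atTop (E := ℂ) |>.eventually_ge_atTop 1
  refine hcont.locallyIntegrable.integrable_of_isBigO_cocompact
    (g := fun z : ℂ => (1 + ‖z‖) ^ (-3 : ℝ)) ?_ (hint.integrableAtFilter _)
  -- For `|z| ≥ 1` one has `(1 + |z|)^3 ≤ (2|z|)^3`, whence `8`.
  refine Asymptotics.IsBigO.of_bound 8 ?_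
  filter_upwards [h2, h3] with z hz hz1
  have hz0 : 0 < ‖z‖ := one_pos.trans_le hz1
  have e1 : (2 * ‖z‖ ^ α) ^ (3 / α) = 2 ^ (3 / α) * ‖z‖ ^ 3 := by
    rw [Real.mul_rpow two_pos.le (by positivity), ← Real.rpow_mul hz0.le,
      mul_div_cancel₀ _ hα.ne', ← Real.rpow_natCast]
    norm_num
  have e2 : (1 : ℝ) ≤ 2 ^ (3 / α) := Real.one_le_rpow one_le_two (by positivity)
  simp only [Function.comp_apply, e1] at hz
  have e3 : -1 * (2 * ‖z‖ ^ α) = -2 * ‖z‖ ^ α := by ring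
  rw [e3] at hz
  have e4 : ‖z‖ ^ 3 * Real.exp (-2 * ‖z‖ ^ α) ≤ 1 := by
    refine le_trans ?_ hz.le
    rw [mul_assoc]
    exact le_mul_of_one_le_left (by positivity) e2
  rw [Real.norm_of_nonneg (by positivity), Real.norm_of_nonneg (by positivity),
    Real.rpow_neg (by positivity), ← div_eq_mul_inv, le_div_iff₀ (by positivity)]
  have e5 : (1 + ‖z‖) ^ (3 : ℝ) ≤ 8 * ‖z‖ ^ 3 := by
    rw [show (3 : ℝ) = (3 : ℕ) by norm_num, Real.rpow_natCast]
    calc (1 + ‖z‖) ^ 3 ≤ (2 * ‖z‖) ^ 3 := by gcongr; linarith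
      _ = 8 * ‖z‖ ^ 3 := by ring
  nlinarith [Real.exp_pos (-2 * ‖z‖ ^ α)]

theorem memLp_const_mul_weight {α : ℝ} (hα : 0 < α) (c : ℂ) :
    MemLp (fun z : ℂ => c * (Real.exp (-‖z‖ ^ α) : ℂ)) 2 volume := by
  have hcont : Continuous fun z : ℂ => c * (Real.exp (-‖z‖ ^ α) : ℂ) := by
    have : Continuous fun z : ℂ => ‖z‖ ^ α :=
      continuous_norm.rpow_const fun _ => Or.inr hα.le
    fun_prop
  rw [memLp_two_iff_integrable_sq_norm hcont.aestronglyMeasurable]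
  refine ((integrable_exp_neg_norm_rpow hα).const_mul (‖c‖ ^ 2)).congr
    (Filter.Eventually.of_forall fun z => ?_)
  simp only [norm_mul, Complex.norm_real, Real.norm_eq_abs, Real.abs_exp, mul_pow, ← Real.exp_nat_mul]
  congr 2
  push_cast; ring

/-- The constant function `1`. -/
noncomputable def constOne {α : ℝ} (hα : 0 < α) : constFunctions α :=
  ⟨⟨fun _ => 1, differentiable_const 1, memLp_const_mul_weight hα 1⟩, 1, fun _ => rfl⟩

theorem finrank_constFunctions {α : ℝ} (hα : 0 < α) :
    Module.finrank ℂ (constFunctions α) = 1 := by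
  refine finrank_eq_one (constOne hα) (fun h => ?_) fun f => ?_
  · have := congrArg (fun f : constFunctions α => (f.1 : ℂ → ℂ) 0) h
    exact one_ne_zero this
  · obtain ⟨c, hc⟩ := f.2
    refine ⟨c, Subtype.ext (Subtype.ext (funext fun z => ?_))⟩
    change c * 1 = _
    rw [mul_one]
    exact (hc z).symm

/-! ### Diagonal operators on `ℓ²` sums -/

section Diagonal

variable {ι : Type} {F : Type*} [NormedAddCommGroup F] [InnerProductSpace ℂ F]

/-- `T` acts on the `i`-th summand as multiplication by `d i`. -/
def IsDiagonal (T : lp (fun _ : ι => F) 2 →L[ℂ] lp (fun _ : ι => F) 2) (d : ι → ℂ) : Prop :=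
  ∀ x i, T x i = d i • x i

namespace IsDiagonal

variable {T S : lp (fun _ : ι => F) 2 →L[ℂ] lp (fun _ : ι => F) 2} {d e : ι → ℂ}

theorem zero : IsDiagonal (0 : lp (fun _ : ι => F) 2 →L[ℂ] lp (fun _ : ι => F) 2) 0 := fun x i => by
  simp

theorem one : IsDiagonal (1 : lp (fun _ : ι => F) 2 →L[ℂ] lp (fun _ : ι => F) 2) 1 := fun x i => by
  simp

theorem add (hT : IsDiagonal T d) (hS : IsDiagonal S e) : IsDiagonal (T + S) (d + e) :=
  fun x i => by
    simp [hT x i, hS x i, add_smul]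

theorem sub (hT : IsDiagonal T d) (hS : IsDiagonal S e) : IsDiagonal (T - S) (d - e) :=
  fun x i => by
    simp [hT x i, hS x i, sub_smul]

theorem mul (hT : IsDiagonal T d) (hS : IsDiagonal S e) : IsDiagonal (T * S) (d * e) :=
  fun x i => by
    rw [mul_apply_eq_comp, hT, hS, smul_smul, Pi.mul_apply]

theorem smul (hT : IsDiagonal T d) (c : ℂ) : IsDiagonal (c • T) (c • d) :=
  fun x i => by
    simp [hT x i, smul_smul]

theorem pow (hT : IsDiagonal T d) (n : ℕ) : IsDiagonal (T ^ n) (d ^ n) := by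
  induction n with
  | zero => simpa using one
  | succ n ih => rw [pow_succ, pow_succ]; exact ih.mul hT

theorem sum {κ : Type*} (s : Finset κ) {T : κ → lp (fun _ : ι => F) 2 →L[ℂ] lp (fun _ : ι => F) 2}
    {d : κ → ι → ℂ} (h : ∀ k ∈ s, IsDiagonal (T k) (d k)) :
    IsDiagonal (∑ k ∈ s, T k) (∑ k ∈ s, d k) := by
  classical
  induction s using Finset.induction_on with
  | empty => simpa using zero
  | insert k s hk ih =>
    rw [Finset.sum_insert hk, Finset.sum_insert hk]
    exact (h k (Finset.mem_insert_self k s)).add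
      (ih fun j hj => h j (Finset.mem_insert_of_mem hj))

/-- Evaluation of `T x` at `i` as a continuous linear functional of `T`. -/
noncomputable def evalCoord (x : lp (fun _ : ι => F) 2) (i : ι) :
    (lp (fun _ : ι => F) 2 →L[ℂ] lp (fun _ : ι => F) 2) →L[ℂ] F :=
  (lp.evalCLM ℂ (fun _ : ι => F) 2 i).comp (ContinuousLinearMap.apply ℂ _ x)

theorem exp [CompleteSpace F] (hT : IsDiagonal T d) :
    IsDiagonal (NormedSpace.exp T) fun i => Complex.exp (d i) := fun x i => by
  have h1 := (NormedSpace.exp_series_hasSum_exp' (𝕂 := ℂ) T).mapL (evalCoord x i)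
  have h2 := (NormedSpace.exp_series_hasSum_exp' (𝕂 := ℂ) (d i)).smul_const (x i)
  rw [← Complex.exp_eq_exp_ℂ] at h2
  refine h1.unique ?_
  convert h2 using 2 with n
  rw [map_smul, smul_assoc]
  congr 1
  exact (hT.pow n) x i

theorem regularizer [CompleteSpace F] (hT : IsDiagonal T d) (n : ℕ) :
    IsDiagonal (regularizer n T) fun i => (1 + d i) *
      Complex.exp (∑ j ∈ Finset.Ico 1 n, ((-1 : ℂ) ^ j * (j : ℂ)⁻¹) * d i ^ j) - 1 := by
  have h := ((one.add hT).mul (sum (Finset.Ico 1 n) fun j _ =>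
    (hT.pow j).smul ((-1 : ℂ) ^ j * (j : ℂ)⁻¹)).exp).sub one
  intro x i
  refine (h x i).trans ?_
  simp

/-- `(T - l)^k` multiplies the `i`-th coordinate by `(d i - l)^k`, which is injective unless `d i =
l`. There are no Jordan blocks, so the exponent `1` already suffices. -/
theorem mem_maxGenEigenspace_iff (hT : IsDiagonal T d) (l : ℂ) (x : lp (fun _ : ι => F) 2) :
    x ∈ Module.End.maxGenEigenspace (T : Module.End ℂ (lp (fun _ : ι => F) 2)) l ↔
      ∀ i, d i ≠ l → x i = 0 := by
  have hpow : ∀ k : ℕ, ∀ i, (((T : Module.End ℂ (lp (fun _ : ι => F) 2)) - l • 1) ^ k) x i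
      = (d i - l) ^ k • x i := by
    intro k i
    have h := ((hT.sub (one.smul l)).pow k) x i
    have hc : (((T : Module.End ℂ (lp (fun _ : ι => F) 2)) - l • 1) ^ k) x
        = ((T - l • (1 : lp (fun _ : ι => F) 2 →L[ℂ] lp (fun _ : ι => F) 2)) ^ k) x := by
      clear h
      induction k generalizing x with
      | zero => rfl
      | succ k ih =>
        rw [pow_succ, pow_succ, Module.End.mul_apply, mul_apply_eq_comp, ih]
        rfl
    rw [hc, h]
    simp
  rw [Module.End.mem_maxGenEigenspace]
  constructor
  · rintro ⟨k, hk⟩ i hi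
    have := hpow k i
    rw [hk] at this
    exact (smul_eq_zero.mp this.symm).resolve_left (pow_ne_zero k (sub_ne_zero.mpr hi))
  · intro h
    refine ⟨1, lp.ext (funext fun i => ?_)⟩
    rw [hpow]
    by_cases hi : d i = l
    · simp [hi]
    · simp [h i hi]

/-- The generalized eigenspace is the space of vectors supported on the fibre over `l`; restriction
to that finite fibre identifies it with a power of the line `F`. -/
theorem algMultiplicity_eq (hT : IsDiagonal T d) (hF : Module.finrank ℂ F = 1) {l : ℂ}
    (hl : Finite {i // d i = l}) : algMultiplicity T l = Nat.card {i // d i = l} := by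
  classical
  have : Fintype {i // d i = l} := Fintype.ofFinite _
  let W := Module.End.maxGenEigenspace (T : Module.End ℂ (lp (fun _ : ι => F) 2)) l
  let r : W →ₗ[ℂ] ({i // d i = l} → F) :=
    { toFun := fun x i => x.1 i.1
      map_add' := fun x y => rfl
      map_smul' := fun c x => rfl }
  have hr : Function.Bijective r := by
    constructor
    · intro x y hxy
      refine Subtype.ext (lp.ext (funext fun i => ?_))
      by_cases hi : d i = l
      · exact congrFun hxy ⟨i, hi⟩
      · rw [(hT.mem_maxGenEigenspace_iff l x.1).mp x.2 i hi,
          (hT.mem_maxGenEigenspace_iff l y.1).mp y.2 i hi]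
    · intro v
      let x : lp (fun _ : ι => F) 2 := ∑ j : {i // d i = l}, lp.single 2 j.1 (v j)
      have hx : ∀ i, x i = ∑ j : {i // d i = l}, Pi.single (M := fun _ => F) j.1 (v j) i := by
        intro i
        simp only [x, AddSubgroup.val_finsetSum, lp.coeFn_single]
        exact Finset.sum_apply i _ _
      have hxW : x ∈ W := (hT.mem_maxGenEigenspace_iff l x).mpr fun i hi => by
        rw [hx]
        refine Finset.sum_eq_zero fun j _ => Pi.single_eq_of_ne ?_ _
        rintro rfl
        exact hi j.2
      refine ⟨⟨x, hxW⟩, funext fun i => ?_⟩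
      change x i.1 = v i
      rw [hx, Finset.sum_eq_single i]
      · simp
      · intro j _ hj
        exact Pi.single_eq_of_ne (fun h => hj (Subtype.ext h.symm)) _
      · simp
  have hfin : FiniteDimensional ℂ F := Module.finite_of_finrank_pos (by omega)
  change Module.finrank ℂ W = _
  rw [(LinearEquiv.ofBijective r hr).finrank_eq, Module.finrank_pi_fintype]
  simp [hF]

/-- Grouping the factors `1 + d i` by the value of `d i` gives the product over eigenvalues;
summability makes the nonzero fibres finite and the regrouping legitimate. -/
theorem fredholmDet_eq (hT : IsDiagonal T d) (hF : Module.finrank ℂ F = 1)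
    (hd : Summable fun i => ‖d i‖) : fredholmDet T = ∏' i, (1 + d i) := by
  have hfib : ∀ l : ℂ, l ≠ 0 → Finite {i // d i = l} := fun l hl => by
    have h := hd.tendsto_cofinite_zero.eventually (gt_mem_nhds (norm_pos_iff.mpr hl))
    rw [Filter.eventually_cofinite] at h
    exact (h.subset fun i (hi : d i = l) => by simp [hi]).to_subtype
  have hprod := (multipliable_one_add_of_summable hd).hasProd
  rw [← (Equiv.sigmaFiberEquiv d).hasProd_iff] at hprod
  -- The fibre over `0` may be infinite, with no finite multiplicity, but all its factors are `1`.
  have h2 : HasProd (fun l : ℂ => if l = 0 then 1 else (1 + l) ^ algMultiplicity T l)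
      (∏' i, (1 + d i)) := by
    refine hprod.sigma fun l => ?_
    have hval : ∀ c : {i // d i = l}, ((fun i => 1 + d i) ∘ Equiv.sigmaFiberEquiv d) ⟨l, c⟩
        = 1 + l := fun c => by
      change 1 + d c.1 = 1 + l
      rw [c.2]
    simp only [hval]
    split_ifs with hl
    · subst hl
      simp [hasProd_one]
    · have := hfib l hl
      have : Fintype {i // d i = l} := Fintype.ofFinite _
      rw [hT.algMultiplicity_eq hF (hfib l hl), Nat.card_eq_fintype_card]
      simpa using hasProd_fintype (fun _ : {i // d i = l} => 1 + l)
  rw [← h2.tprod_eq, fredholmDet, ← tprod_subtype_eq_of_mulSupport_subset (s := {l : ℂ | l ≠ 0})]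
  · refine tprod_congr fun l => ?_
    rw [if_neg l.2]
  · intro l hl h0
    exact hl (if_pos h0)

end IsDiagonal

end Diagonal

/-! ### Compactness and singular value expansion of diagonal operators -/

section Diagonal

variable {ι : Type} {F : Type*} [NormedAddCommGroup F] [InnerProductSpace ℂ F]
variable {T : lp (fun _ : ι => F) 2 →L[ℂ] lp (fun _ : ι => F) 2} {d : ι → ℂ}

theorem IsDiagonal.norm_le (hT : IsDiagonal T d) {C : ℝ} (hC : 0 ≤ C) (hd : ∀ i, ‖d i‖ ≤ C) :
    ‖T‖ ≤ C := by
  refine ContinuousLinearMap.opNorm_le_bound _ hC fun x => ?_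
  have h : ‖(C : ℂ) • x‖ = C * ‖x‖ := by
    rw [norm_smul, Complex.norm_real, Real.norm_of_nonneg hC]
  rw [← h]
  refine lp.norm_mono (by norm_num) fun i => ?_
  change ‖T x i‖ ≤ ‖(C : ℂ) • x i‖
  rw [hT, norm_smul, norm_smul, Complex.norm_real, Real.norm_of_nonneg hC]
  exact mul_le_mul_of_nonneg_right (hd i) (norm_nonneg _)

theorem IsDiagonal.isCompactOperator [FiniteDimensional ℂ F] (hT : IsDiagonal T d)
    (hd : Filter.Tendsto d Filter.cofinite (nhds 0)) : IsCompactOperator T := by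
  classical
  have : CompleteSpace F := FiniteDimensional.complete ℂ F
  have : ProperSpace F := FiniteDimensional.proper ℂ F
  let R : ι → lp (fun _ : ι => F) 2 →L[ℂ] lp (fun _ : ι => F) 2 := fun i =>
    (lp.singleContinuousLinearMap ℂ (fun _ : ι => F) 2 i).comp
      (d i • lp.evalCLM ℂ (fun _ : ι => F) 2 i)
  have hR : ∀ i, IsDiagonal (R i) (Pi.single i (d i)) := fun i x j => by
    change (lp.single (E := fun _ : ι => F) 2 i (d i • x i)) j = _
    rw [lp.single_apply]
    by_cases h : j = i
    · subst h; simp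
    · simp [h]
  have hRc : ∀ i, IsCompactOperator (R i) := fun i =>
    (isCompactOperator_of_locallyCompactSpace_dom
      (d i • lp.evalCLM ℂ (fun _ : ι => F) 2 i)).clm_comp
      (lp.singleContinuousLinearMap ℂ (fun _ : ι => F) 2 i)
  refine isCompactOperator_of_tendsto (l := Filter.atTop) (F := fun s : Finset ι => ∑ i ∈ s, R i)
    ?_ (Filter.Eventually.of_forall fun s => ?_)
  · rw [Metric.tendsto_atTop]
    intro ε hε
    have hfin := hd.norm.eventually (gt_mem_nhds (show ‖(0 : ℂ)‖ < ε / 2 by simpa using hε))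
    rw [Filter.eventually_cofinite] at hfin
    -- Once the finitely many entries with `|d i| ≥ ε / 2` are kept, the truncation error is
    -- diagonal with entries of size at most `ε / 2`.
    refine ⟨hfin.toFinset, fun s hs => ?_⟩
    rw [dist_eq_norm]
    have hdiag := (IsDiagonal.sum s (T := R) fun i _ => hR i).sub hT
    refine lt_of_le_of_lt (hdiag.norm_le (C := ε / 2) (by positivity) fun i => ?_) (by linarith)
    rw [Pi.sub_apply, Finset.sum_apply]
    by_cases hi : i ∈ s
    · rw [Finset.sum_eq_single i (fun j _ hj => Pi.single_eq_of_ne hj.symm _)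
        (fun h => absurd hi h), Pi.single_eq_same, sub_self, norm_zero]
      positivity
    · have hz : ∑ j ∈ s, Pi.single (M := fun _ => ℂ) j (d j) i = 0 :=
        Finset.sum_eq_zero fun j hj => Pi.single_eq_of_ne (by rintro rfl; exact hi hj) _
      rw [hz, zero_sub, norm_neg]
      by_contra hlt
      refine hi (hs ?_)
      simpa using (not_le.mp hlt).le
  · induction s using Finset.induction_on with
    | empty => exact isCompactOperator_zero
    | insert i s hi ih =>
      rw [Finset.sum_insert hi]
      exact (hRc i).add ih

theorem IsDiagonal.memTraceIdeal (hT : IsDiagonal T d) (hF : Module.finrank ℂ F = 1)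
    (hd0 : ∀ i, d i ≠ 0) {p : ℕ} (hp : p ≠ 0) (hd : Summable fun i => ‖d i‖ ^ p) :
    MemTraceIdeal p T := by
  classical
  have hfd : FiniteDimensional ℂ F := Module.finite_of_finrank_pos (by omega)
  have : Nontrivial F := Module.nontrivial_of_finrank_pos (R := ℂ) (by omega)
  refine ⟨hT.isCompactOperator ?_, ?_⟩
  · rw [tendsto_zero_iff_norm_tendsto_zero]
    have h := hd.tendsto_cofinite_zero.rpow_const (p := (p : ℝ)⁻¹) (Or.inr (by positivity))
    rw [Real.zero_rpow (by positivity)] at h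
    exact h.congr fun i => Real.pow_rpow_inv_natCast (norm_nonneg _) hp
  obtain ⟨u, hu⟩ := exists_norm_eq F zero_le_one
  have hu0 : u ≠ 0 := by rintro rfl; simp at hu
  have huu : ∀ y : F, inner ℂ u y • u = y := fun y => by
    obtain ⟨c, rfl⟩ := (finrank_eq_one_iff_of_nonzero' u hu0).mp hF y
    rw [inner_smul_right, inner_self_eq_norm_sq_to_K, hu]
    simp
  have hon : Orthonormal ℂ fun i : ι => (lp.single 2 i u : lp (fun _ : ι => F) 2) := by
    rw [orthonormal_iff_ite]
    intro i j
    rw [lp.inner_single_left, lp.single_apply]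
    by_cases h : i = j
    · subst h
      simp [inner_self_eq_norm_sq_to_K, hu]
    · simp [h]
  -- The singular values are `|d i|`; the phase `d i / |d i|` is moved into the second orthonormal
  -- family.
  refine ⟨ι, fun i => lp.single 2 i u, fun i => (d i / ‖d i‖) • lp.single 2 i u, fun i => ‖d i‖,
    hon, ?_, fun i => norm_pos_iff.mpr (hd0 i), fun x => ?_, hd⟩
  · rw [orthonormal_iff_ite] at hon ⊢
    intro i j
    rw [inner_smul_left, inner_smul_right, hon i j]
    by_cases h : i = j
    · subst h
      have h0 : (‖d i‖ : ℂ) ≠ 0 := by simpa using hd0 i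
      rw [if_pos rfl, mul_one, mul_comm, Complex.mul_conj, Complex.normSq_eq_norm_sq, norm_div,
        Complex.norm_real, norm_norm, div_self (by simpa using hd0 i)]
      simp
    · simp [h]
  · convert lp.hasSum_single (p := 2) (by norm_num) (T x) using 2 with i
    have h0 : (‖d i‖ : ℂ) ≠ 0 := by simpa using hd0 i
    rw [lp.inner_single_left, smul_smul, hT, ← lp.single_smul]
    congr 1
    conv_rhs => rw [← huu (x i)]
    rw [smul_smul]
    congr 1
    field_simp

end Diagonal

/-! ### Regularized determinants of the operators `D_f` -/

theorem isDiagonal_entireOp (α : ℝ) {f : ℂ → ℂ} (hf : Differentiable ℂ f) (h0 : f 0 ≠ 0) :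
    IsDiagonal (entireOp α f hf h0) fun i => ((i.1 : ℂ))⁻¹ := fun x i =>
  translatedDeriv_apply _ (x i)

theorem zeroIndex_ne_zero {f : ℂ → ℂ} (h0 : f 0 ≠ 0) (i : ZeroIndex f) : (i.1 : ℂ) ≠ 0 :=
  fun h => h0 ((congrArg f h).symm.trans i.1.2)

theorem memTraceIdeal_entireOp {α : ℝ} (hα : 0 < α) {f : ℂ → ℂ} (hf : Differentiable ℂ f)
    (h0 : f 0 ≠ 0) {p : ℕ} (hp : p ≠ 0)
    (hs : Summable fun i : ZeroIndex f => ‖((i.1 : ℂ))⁻¹‖ ^ p) :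
    MemTraceIdeal p (entireOp α f hf h0) :=
  (isDiagonal_entireOp α hf h0).memTraceIdeal (finrank_constFunctions hα)
    (fun i => inv_ne_zero (zeroIndex_ne_zero h0 i)) hp hs

/-- The linear terms of `1 - w` and `exp w` cancel, leaving two quadratic errors. This is why square
summability of the reciprocal zeros suffices for genus-one products. -/
theorem norm_one_sub_mul_exp_sub_one_le (w : ℂ) :
    ‖(1 - w) * Complex.exp w - 1‖ ≤ 2 * ‖w‖ ^ 2 * Real.exp ‖w‖ := by
  have h1 := Complex.norm_exp_sub_sum_le_norm_mul_exp w 1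
  have h2 := Complex.norm_exp_sub_sum_le_norm_mul_exp w 2
  simp only [Finset.sum_range_succ, Finset.range_zero, Finset.sum_empty, pow_zero, pow_one,
    Nat.factorial, Nat.cast_one, zero_add, div_one, mul_one] at h1 h2
  have e : (1 - w) * Complex.exp w - 1
      = (Complex.exp w - (1 + w)) - w * (Complex.exp w - 1) := by ring
  rw [e]
  refine (norm_sub_le _ _).trans ?_
  rw [norm_mul]
  nlinarith [mul_le_mul_of_nonneg_left h1 (norm_nonneg w)]

theorem regDet_one_entireOp {α : ℝ} (hα : 0 < α) {f : ℂ → ℂ} (hf : Differentiable ℂ f)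
    (h0 : f 0 ≠ 0) (hs : Summable fun i : ZeroIndex f => ‖((i.1 : ℂ))⁻¹‖) (s : ℂ) :
    regDet 1 (-s • entireOp α f hf h0) = ∏' i : ZeroIndex f, (1 - s * ((i.1 : ℂ))⁻¹) := by
  have hE := finrank_constFunctions hα
  have : FiniteDimensional ℂ (constFunctions α) := Module.finite_of_finrank_pos (by omega)
  have : CompleteSpace (constFunctions α) := FiniteDimensional.complete ℂ _
  have hd := ((isDiagonal_entireOp α hf h0).smul (-s)).regularizer 1
  rw [regDet, hd.fredholmDet_eq hE]
  · refine tprod_congr fun i => ?_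
    simp [sub_eq_add_neg]
  · refine (hs.mul_left ‖s‖).congr fun i => ?_
    simp

theorem regDet_two_entireOp {α : ℝ} (hα : 0 < α) {f : ℂ → ℂ} (hf : Differentiable ℂ f)
    (h0 : f 0 ≠ 0) (hs : Summable fun i : ZeroIndex f => ‖((i.1 : ℂ))⁻¹‖ ^ 2) (s : ℂ) :
    regDet 2 (-s • entireOp α f hf h0) = ∏' i : ZeroIndex f,
      (1 - s * ((i.1 : ℂ))⁻¹) * Complex.exp (s * ((i.1 : ℂ))⁻¹) := by
  have hE := finrank_constFunctions hα
  have : FiniteDimensional ℂ (constFunctions α) := Module.finite_of_finrank_pos (by omega)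
  have : CompleteSpace (constFunctions α) := FiniteDimensional.complete ℂ _
  have hd := ((isDiagonal_entireOp α hf h0).smul (-s)).regularizer 2
  have e : ∀ i : ZeroIndex f, (1 + ((-s) • fun i : ZeroIndex f => ((i.1 : ℂ))⁻¹) i) *
      Complex.exp (∑ j ∈ Finset.Ico (1 : ℕ) 2, ((-1 : ℂ) ^ j * (j : ℂ)⁻¹) *
        ((-s) • fun i : ZeroIndex f => ((i.1 : ℂ))⁻¹) i ^ j) - 1
      = (1 - s * ((i.1 : ℂ))⁻¹) * Complex.exp (s * ((i.1 : ℂ))⁻¹) - 1 := fun i => by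
    simp [sub_eq_add_neg]
  simp only [e] at hd
  rw [regDet, hd.fredholmDet_eq hE]
  · exact tprod_congr fun i => by ring
  · obtain ⟨C, hC⟩ := bddAbove_inv_zeros hf h0
    refine Summable.of_nonneg_of_le (fun i => norm_nonneg _) (fun i => ?_)
      (hs.mul_left (2 * ‖s‖ ^ 2 * Real.exp (‖s‖ * C)))
    have hi : ‖((i.1 : ℂ))⁻¹‖ ≤ C := hC ⟨i, rfl⟩
    refine (norm_one_sub_mul_exp_sub_one_le _).trans ?_
    rw [norm_mul, mul_pow]
    have : Real.exp (‖s‖ * ‖((i.1 : ℂ))⁻¹‖) ≤ Real.exp (‖s‖ * C) := by gcongr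
    calc 2 * (‖s‖ ^ 2 * ‖((i.1 : ℂ))⁻¹‖ ^ 2) * Real.exp (‖s‖ * ‖((i.1 : ℂ))⁻¹‖)
        ≤ 2 * (‖s‖ ^ 2 * ‖((i.1 : ℂ))⁻¹‖ ^ 2) * Real.exp (‖s‖ * C) := by gcongr
      _ = _ := by ring

/-! ### Canonical products of genus one -/

section CanonicalProduct

variable {ι : Type*} {z : ι → ℂ}

/-- The canonical product `∏ (1 - s z_i) exp (s z_i)` with zeros at the points `1 / z_i`. -/
noncomputable def canonicalProduct (z : ι → ℂ) (s : ℂ) : ℂ :=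
  ∏' i, (1 - s * z i) * Complex.exp (s * z i)

theorem summable_canonicalFactor_sub_one (hz : Summable fun i => ‖z i‖ ^ 2) (R : ℝ) :
    ∃ u : ι → ℝ, Summable u ∧ ∀ i, ∀ s : ℂ, ‖s‖ ≤ R →
      ‖(1 - s * z i) * Complex.exp (s * z i) - 1‖ ≤ u i := by
  -- From `x ≤ 1 + x²`; a uniform bound on `|z i|` controls the exponential in the majorant on the
  -- whole disc.
  have hb : ∀ i, ‖z i‖ ≤ 1 + ∑' j, ‖z j‖ ^ 2 := fun i => by
    have := hz.le_tsum i fun j _ => by positivity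
    nlinarith [sq_nonneg (‖z i‖ - 1)]
  refine ⟨_, hz.mul_left (2 * R ^ 2 * Real.exp (R * (1 + ∑' j, ‖z j‖ ^ 2))), fun i s hs => ?_⟩
  have hR : 0 ≤ R := (norm_nonneg s).trans hs
  refine (norm_one_sub_mul_exp_sub_one_le _).trans ?_
  rw [norm_mul]
  calc 2 * (‖s‖ * ‖z i‖) ^ 2 * Real.exp (‖s‖ * ‖z i‖)
      ≤ 2 * (R * ‖z i‖) ^ 2 * Real.exp (R * (1 + ∑' j, ‖z j‖ ^ 2)) := by
        gcongr
        exact hb i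
    _ = _ := by ring

theorem summable_norm_canonicalFactor_sub_one (hz : Summable fun i => ‖z i‖ ^ 2) (s : ℂ) :
    Summable fun i => ‖(1 - s * z i) * Complex.exp (s * z i) - 1‖ := by
  obtain ⟨u, hu, h⟩ := summable_canonicalFactor_sub_one hz ‖s‖
  exact hu.of_nonneg_of_le (fun _ => norm_nonneg _) fun i => h i s le_rfl

theorem multipliable_canonicalFactor (hz : Summable fun i => ‖z i‖ ^ 2) (s : ℂ) :
    Multipliable fun i => (1 - s * z i) * Complex.exp (s * z i) := by
  simpa using multipliable_one_add_of_summable (summable_norm_canonicalFactor_sub_one hz s)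

theorem differentiable_canonicalFactor (w : ℂ) :
    Differentiable ℂ fun s => (1 - s * w) * Complex.exp (s * w) := by
  fun_prop

theorem tendstoLocallyUniformlyOn_canonicalProduct (hz : Summable fun i => ‖z i‖ ^ 2) (R : ℝ) :
    TendstoLocallyUniformlyOn
      (fun (S : Finset ι) s => ∏ i ∈ S, (1 - s * z i) * Complex.exp (s * z i))
      (canonicalProduct z) Filter.atTop (Metric.ball (0 : ℂ) R) := by
  obtain ⟨u, hu, h⟩ := summable_canonicalFactor_sub_one hz R
  have h1 := hu.hasProdLocallyUniformlyOn_one_add (K := Metric.ball (0 : ℂ) R)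
    (f := fun i s => (1 - s * z i) * Complex.exp (s * z i) - 1) Metric.isOpen_ball
    (Filter.Eventually.of_forall fun i x hx => h i x (mem_ball_zero_iff.mp hx).le)
    fun i => ((differentiable_canonicalFactor (z i)).continuous.sub continuous_const).continuousOn
  simp only [add_sub_cancel] at h1
  exact hasProdLocallyUniformlyOn_iff_tendstoLocallyUniformlyOn.mp h1

theorem differentiable_canonicalProduct (hz : Summable fun i => ‖z i‖ ^ 2) :
    Differentiable ℂ (canonicalProduct z) := by
  intro s
  have h2 : DifferentiableOn ℂ (canonicalProduct z) (Metric.ball (0 : ℂ) (‖s‖ + 1)) := by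
    refine (tendstoLocallyUniformlyOn_canonicalProduct hz (‖s‖ + 1)).differentiableOn
      (Filter.Eventually.of_forall fun S => ?_) Metric.isOpen_ball
    exact (Differentiable.fun_finsetProd
      fun i _ => differentiable_canonicalFactor (z i)).differentiableOn
  exact h2.differentiableAt (Metric.isOpen_ball.mem_nhds (by simp))

/-- Every factor is `1 + O(s²)`, and derivatives pass to locally uniform limits. This is what lets
the exponent of a Hadamard factorization be read off at the origin. -/
theorem deriv_canonicalProduct_zero (hz : Summable fun i => ‖z i‖ ^ 2) :
    deriv (canonicalProduct z) 0 = 0 := by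
  classical
  have hfac : ∀ w : ℂ, HasDerivAt (fun s => (1 - s * w) * Complex.exp (s * w)) 0 0 := fun w => by
    refine (((hasDerivAt_const (0 : ℂ) (1 : ℂ)).sub ((hasDerivAt_id (0 : ℂ)).mul_const w)).mul
      ((hasDerivAt_id (0 : ℂ)).mul_const w).cexp).congr_deriv ?_
    simp
  have hprod : ∀ S : Finset ι,
      HasDerivAt (fun s => ∏ i ∈ S, (1 - s * z i) * Complex.exp (s * z i)) 0 0 := fun S => by
    induction S using Finset.induction_on with
    | empty => simpa using hasDerivAt_const (0 : ℂ) (1 : ℂ)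
    | insert i S hi ih =>
      simp only [Finset.prod_insert hi]
      refine ((hfac (z i)).mul ih).congr_deriv ?_
      simp
  have h := ((tendstoLocallyUniformlyOn_canonicalProduct hz 1).deriv
    (Filter.Eventually.of_forall fun S => (Differentiable.fun_finsetProd
      fun i _ => differentiable_canonicalFactor (z i)).differentiableOn)
    Metric.isOpen_ball).tendsto_at (Metric.mem_ball_self one_pos)
  refine tendsto_nhds_unique h (tendsto_const_nhds.congr fun S => ?_)
  exact (hprod S).deriv.symm

theorem canonicalProduct_zero : canonicalProduct z 0 = 1 := by
  simp [canonicalProduct]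

theorem canonicalProduct_ne_zero (hz : Summable fun i => ‖z i‖ ^ 2) {s : ℂ}
    (hs : ∀ i, s * z i ≠ 1) : canonicalProduct z s ≠ 0 := by
  have := tprod_one_add_ne_zero_of_summable
    (f := fun i => (1 - s * z i) * Complex.exp (s * z i) - 1) (fun i => ?_)
    (summable_norm_canonicalFactor_sub_one hz s)
  · simpa [canonicalProduct] using this
  · simpa [sub_eq_zero] using (hs i).symm

theorem canonicalProduct_eq_mul_compl (hz : Summable fun i => ‖z i‖ ^ 2) (S : Set ι) (s : ℂ) :
    canonicalProduct z s
      = canonicalProduct (fun i : S => z i) s * canonicalProduct (fun i : ↥Sᶜ => z i) s := by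
  have h1 := (multipliable_canonicalFactor (hz.subtype S) s).hasProd
  have h2 := (multipliable_canonicalFactor (hz.subtype Sᶜ) s).hasProd
  exact (HasProd.mul_compl (f := fun i => (1 - s * z i) * Complex.exp (s * z i)) h1 h2).tprod_eq

theorem finite_fiber_of_summable_norm_sq (hz : Summable fun i => ‖z i‖ ^ 2) (s : ℂ) :
    {i | s * z i = 1}.Finite := by
  rcases eq_or_ne s 0 with rfl | hs
  · simp
  have h := hz.tendsto_cofinite_zero.eventually
    (gt_mem_nhds (pow_pos (norm_pos_iff.mpr (inv_ne_zero hs)) 2))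
  rw [Filter.eventually_cofinite] at h
  refine h.subset fun i (hi : s * z i = 1) => ?_
  simp [eq_inv_of_mul_eq_one_right hi]

/-- The finitely many factors vanishing at `a` all equal one function with a simple zero there; the
product of the others is nonzero at `a`. -/
theorem analyticOrderAt_canonicalProduct (hz : Summable fun i => ‖z i‖ ^ 2) (a : ℂ) :
    analyticOrderAt (canonicalProduct z) a = Nat.card {i // a * z i = 1} := by
  let S : Set ι := {i | a * z i = 1}
  have hS : Finite S := (finite_fiber_of_summable_norm_sq hz a).to_subtype
  have : Fintype S := Fintype.ofFinite S
  let g : ℂ → ℂ := fun s => (1 - s * a⁻¹) * Complex.exp (s * a⁻¹)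
  have hg : Differentiable ℂ g := by fun_prop
  have e1 : canonicalProduct (fun i : S => z i) = g ^ Nat.card S := by
    funext s
    have hzi : ∀ i : S, z i = a⁻¹ := fun i => eq_inv_of_mul_eq_one_right i.2
    simp only [canonicalProduct, hzi, Pi.pow_apply, g]
    rw [tprod_fintype, Finset.prod_const, Finset.card_univ, Nat.card_eq_fintype_card]
  have e2 : canonicalProduct z
      = g ^ Nat.card S * canonicalProduct (fun i : ↥Sᶜ => z i) := by
    rw [← e1]
    exact funext fun s => canonicalProduct_eq_mul_compl hz S s
  have hc := differentiable_canonicalProduct (z := fun i : ↥Sᶜ => z i) (hz.subtype Sᶜ)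
  have hc0 : analyticOrderAt (canonicalProduct (fun i : ↥Sᶜ => z i)) a = 0 :=
    (hc.analyticAt a).analyticOrderAt_eq_zero.mpr
      (canonicalProduct_ne_zero (hz.subtype Sᶜ) fun i => i.2)
  rw [e2, analyticOrderAt_mul ((hg.analyticAt a).pow _) (hc.analyticAt a), hc0, add_zero,
    analyticOrderAt_pow (hg.analyticAt a)]
  change Nat.card S • analyticOrderAt g a = Nat.card S
  -- At `a = 0` the default `a⁻¹ = 0` makes `g` constant, but then `S` is empty and the power of `g`
  -- is trivial.
  rcases isEmpty_or_nonempty S with h | ⟨⟨i, hi⟩⟩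
  · simp
  have ha : a ≠ 0 := by
    rintro rfl
    simp [S] at hi
  have hg1 : analyticOrderAt g a = 1 := by
    refine (hg.analyticAt a).analyticOrderAt_eq_one_of_zero_deriv_ne_zero ?_ ?_
    · simp [g, ha]
    · have hd : HasDerivAt g ((0 - 1 * a⁻¹) * Complex.exp (a * a⁻¹)
          + (1 - a * a⁻¹) * (Complex.exp (a * a⁻¹) * (1 * a⁻¹))) a :=
        ((hasDerivAt_const a (1 : ℂ)).sub ((hasDerivAt_id a).mul_const a⁻¹)).mul
          ((hasDerivAt_id a).mul_const a⁻¹).cexp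
      rw [hd.deriv]
      simp [ha]
  rw [hg1]
  simp

/-- For `|w| ≤ 1/2` a factor differs from `1` by at most `x = 3|w|² ≤ 3/4`, and `1 - x ≥ exp(-4x)`
on `[0, 3/4]`; hence `12 = 4 · 3`. -/
theorem exp_neg_le_norm_canonicalProduct (hz : Summable fun i => ‖z i‖ ^ 2) {s : ℂ}
    (hs : ∀ i, ‖s * z i‖ ≤ 1 / 2) :
    Real.exp (-(12 * ‖s‖ ^ 2 * ∑' i, ‖z i‖ ^ 2)) ≤ ‖canonicalProduct z s‖ := by
  have hfac : ∀ i, Real.exp (-(12 * ‖s‖ ^ 2 * ‖z i‖ ^ 2))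
      ≤ ‖(1 - s * z i) * Complex.exp (s * z i)‖ := fun i => by
    set w := s * z i with hw
    have hw' := hs i
    have h1 : ‖(1 - w) * Complex.exp w - 1‖ ≤ 3 * ‖w‖ ^ 2 := by
      have h1 := Complex.norm_exp_sub_one_sub_id_le (x := w) (by linarith)
      have h2 := Complex.norm_exp_sub_one_le (x := w) (by linarith)
      have e : (1 - w) * Complex.exp w - 1
          = (Complex.exp w - 1 - w) - w * (Complex.exp w - 1) := by ring
      rw [e]
      refine (norm_sub_le _ _).trans ?_
      rw [norm_mul]
      nlinarith [mul_le_mul_of_nonneg_left h2 (norm_nonneg w)]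
    have h2 : 1 - 3 * ‖w‖ ^ 2 ≤ ‖(1 - w) * Complex.exp w‖ := by
      have := norm_sub_norm_le (1 : ℂ) (1 - (1 - w) * Complex.exp w)
      rw [sub_sub_cancel, norm_one, norm_sub_rev] at this
      linarith
    refine le_trans ?_ h2
    have e : 12 * ‖s‖ ^ 2 * ‖z i‖ ^ 2 = 4 * (3 * ‖w‖ ^ 2) := by
      rw [hw, norm_mul]; ring
    rw [e, Real.exp_neg]
    set x := 3 * ‖w‖ ^ 2 with hx
    have hx0 : 0 ≤ x := by positivity
    have hx1 : x ≤ 3 / 4 := by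
      have := norm_nonneg w
      nlinarith
    refine inv_le_of_inv_le₀ (by linarith) (le_trans ?_ (Real.add_one_le_exp (4 * x)))
    rw [inv_le_iff_one_le_mul₀ (by linarith)]
    nlinarith
  have hm := (multipliable_canonicalFactor hz s).hasProd.norm
  refine ge_of_tendsto hm (Filter.Eventually.of_forall fun S => ?_)
  refine le_trans ?_ (Finset.prod_le_prod (fun i _ => (Real.exp_pos _).le) fun i _ => hfac i)
  rw [← Real.exp_sum, Finset.sum_neg_distrib, ← Finset.mul_sum]
  gcongr
  exact hz.sum_le_tsum S fun i _ => by positivity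

end CanonicalProduct

/-! ### Zeros with multiplicity -/

/-- The indices of the zeros equal to `a` number the order of `f` at `a`. -/
noncomputable def zeroIndexFiberEquiv {f : ℂ → ℂ} {a : ℂ} (ha : f a = 0) :
    {i : ZeroIndex f // (i.1 : ℂ) = a} ≃ Fin (analyticOrderNatAt f a) :=
  (Equiv.subtypeEquivRight fun i => by
    rw [Subtype.ext_iff]).trans
    (Equiv.sigmaSubtype (α := {a : ℂ // f a = 0}) (β := fun a => Fin (analyticOrderNatAt f a))
      (⟨a, ha⟩ : {a : ℂ // f a = 0}))

theorem finite_zeroIndex_fiber (f : ℂ → ℂ) (a : ℂ) :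
    Finite {i : ZeroIndex f // (i.1 : ℂ) = a} := by
  by_cases ha : f a = 0
  · exact Finite.of_equiv _ (zeroIndexFiberEquiv ha).symm
  · have : IsEmpty {i : ZeroIndex f // (i.1 : ℂ) = a} :=
      ⟨fun i => ha (i.2 ▸ i.1.1.2)⟩
    infer_instance

theorem card_zeroIndex_fiber (f : ℂ → ℂ) (a : ℂ) :
    Nat.card {i : ZeroIndex f // (i.1 : ℂ) = a} = analyticOrderNatAt f a := by
  by_cases ha : f a = 0
  · rw [Nat.card_congr (zeroIndexFiberEquiv ha), Nat.card_fin]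
  · have : IsEmpty {i : ZeroIndex f // (i.1 : ℂ) = a} :=
      ⟨fun i => ha (i.2 ▸ i.1.1.2)⟩
    rw [Nat.card_of_isEmpty]
    by_contra h
    exact ha (apply_eq_zero_of_analyticOrderNatAt_ne_zero (Ne.symm h))

theorem mul_inv_zeroIndex_eq_one_iff {f : ℂ → ℂ} (h0 : f 0 ≠ 0) (a : ℂ) (i : ZeroIndex f) :
    a * ((i.1 : ℂ))⁻¹ = 1 ↔ (i.1 : ℂ) = a := by
  rw [mul_inv_eq_one₀ (zeroIndex_ne_zero h0 i), eq_comm]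

/-- Equal multiplicities at every point allow the fibres over each zero to be matched by
cardinality. This replaces the abstract index of zeros by an explicit family. -/
theorem exists_zeroIndex_equiv {ι : Type*} {f : ℂ → ℂ} {z : ι → ℂ} (hz : ∀ i, z i ≠ 0)
    (hfin : ∀ a, Finite {i // a * z i = 1})
    (h : ∀ a, analyticOrderAt f a = Nat.card {i // a * z i = 1}) :
    ∃ e : ZeroIndex f ≃ ι, ∀ i, z (e i) = ((i.1 : ℂ))⁻¹ := by
  have hzero : ∀ i, f (z i)⁻¹ = 0 := fun i => by
    apply apply_eq_zero_of_analyticOrderAt_ne_zero (𝕜 := ℂ)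
    rw [h]
    have := hfin (z i)⁻¹
    have : Nonempty {j // (z i)⁻¹ * z j = 1} := ⟨⟨i, inv_mul_cancel₀ (hz i)⟩⟩
    exact_mod_cast Nat.card_pos.ne'
  let g : ι → {a : ℂ // f a = 0} := fun i => ⟨(z i)⁻¹, hzero i⟩
  have hg : ∀ (a : {a : ℂ // f a = 0}) (i : ι), g i = a ↔ (a : ℂ) * z i = 1 := fun a i => by
    rw [Subtype.ext_iff, mul_eq_one_iff_eq_inv₀ (hz i), eq_comm]
  have hE : ∀ a : {a : ℂ // f a = 0},
      Nonempty (Fin (analyticOrderNatAt f a) ≃ {i // g i = a}) := fun a => by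
    have := hfin a
    have hc : Nat.card {i // (a : ℂ) * z i = 1} = analyticOrderNatAt f a := by
      rw [analyticOrderNatAt, h, ENat.toNat_natCast]
    exact ⟨(Finite.equivFinOfCardEq hc).symm.trans
      (Equiv.subtypeEquivRight fun i => (hg a i).symm)⟩
  refine ⟨(Equiv.sigmaCongrRight fun a => (hE a).some).trans (Equiv.sigmaFiberEquiv g), ?_⟩
  rintro ⟨a, k⟩
  have := (hg a _).mp ((hE a).some k).2
  exact eq_inv_of_mul_eq_one_right this

/-- The family of the reciprocals of the zeros. -/
noncomputable def invZeros (f : ℂ → ℂ) (i : ZeroIndex f) : ℂ := ((i.1 : ℂ))⁻¹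

theorem canonicalProduct_invZeros_of_eq {ι : Type*} {f : ℂ → ℂ} {z : ι → ℂ} (hz0 : ∀ i, z i ≠ 0)
    (hz : Summable fun i => ‖z i‖ ^ 2) {c B : ℂ} (hc : c ≠ 0)
    (h : ∀ s, f s = c * Complex.exp (B * s) * canonicalProduct z s) :
    (∃ e : ZeroIndex f ≃ ι, ∀ i, z (e i) = invZeros f i) ∧
      canonicalProduct (invZeros f) = canonicalProduct z := by
  have hP := differentiable_canonicalProduct hz
  have hord : ∀ a, analyticOrderAt f a = Nat.card {i // a * z i = 1} := fun a => by
    have he : Differentiable ℂ fun s => c * Complex.exp (B * s) := by fun_prop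
    rw [show f = (fun s => c * Complex.exp (B * s)) * canonicalProduct z from funext h,
      analyticOrderAt_mul (he.analyticAt a) (hP.analyticAt a),
      (he.analyticAt a).analyticOrderAt_eq_zero.mpr (mul_ne_zero hc (Complex.exp_ne_zero _)),
      zero_add, analyticOrderAt_canonicalProduct hz]
  obtain ⟨e, he⟩ := exists_zeroIndex_equiv hz0
    (fun a => (finite_fiber_of_summable_norm_sq hz a).to_subtype) hord
  refine ⟨⟨e, he⟩, funext fun s => ?_⟩
  rw [canonicalProduct, canonicalProduct, ← e.tprod_eq]
  exact tprod_congr fun i => by rw [he, invZeros]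

/-! ### Division of entire functions -/

/-- The quotient `f / p` is meromorphic with nonnegative order everywhere, so its normal form is
analytic; the identity `f = p q` extends across the zeros of `p` by continuity. -/
theorem exists_entire_mul_eq {f p : ℂ → ℂ} (hf : Differentiable ℂ f) (hp : Differentiable ℂ p)
    (hp0 : ∀ a, analyticOrderAt p a ≠ ⊤) (h : ∀ a, analyticOrderAt p a ≤ analyticOrderAt f a) :
    ∃ q : ℂ → ℂ, Differentiable ℂ q ∧ f = p * q := by
  have hm : MeromorphicOn (f / p) Set.univ := fun a _ =>
    (hf.analyticAt a).meromorphicAt.div (hp.analyticAt a).meromorphicAt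
  let q := toMeromorphicNFOn (f / p) Set.univ
  have hq : ∀ a, AnalyticAt ℂ q a := fun a => by
    rw [← (meromorphicNFOn_toMeromorphicNFOn (f / p) Set.univ
      (Set.mem_univ a)).meromorphicOrderAt_nonneg_iff_analyticAt,
      meromorphicOrderAt_toMeromorphicNFOn hm (Set.mem_univ a),
      meromorphicOrderAt_div (hf.analyticAt a).meromorphicAt (hp.analyticAt a).meromorphicAt,
      (hf.analyticAt a).meromorphicOrderAt_eq, (hp.analyticAt a).meromorphicOrderAt_eq]
    have h1 := hp0 a
    have h2 := h a
    generalize analyticOrderAt p a = m at *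
    generalize analyticOrderAt f a = n at *
    obtain ⟨m, rfl⟩ := ENat.ne_top_iff_exists.mp h1
    cases n using ENat.recTopCoe with
    | top => simp
    | coe n =>
      have : m ≤ n := by exact_mod_cast h2
      simp only [ENat.map_natCast]
      norm_cast
      omega
  refine ⟨q, fun a => (hq a).differentiableAt, funext fun a => ?_⟩
  have hne : ∀ᶠ z in nhdsWithin a {a}ᶜ, p z ≠ 0 :=
    (hp.analyticAt a).eventually_eq_zero_or_eventually_ne_zero.resolve_left fun h =>
      hp0 a (analyticOrderAt_eq_top.mpr h)
  have hev : f =ᶠ[nhdsWithin a {a}ᶜ] p * q := by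
    filter_upwards [hm.toMeromorphicNFOn_eq_self_on_nhdsNE (Set.mem_univ a), hne] with z hz hpz
    rw [Pi.mul_apply, show q z = (f / p) z from hz, Pi.div_apply, mul_div_cancel₀ _ hpz]
  exact (((hf.continuous.continuousAt).eventuallyEq_nhds_iff_eventuallyEq_nhdsNE
    ((hp.continuous.continuousAt).mul (hq a).continuousAt)).mp hev).eq_of_nhds

theorem analyticOrderAt_ne_top_of_entire {f : ℂ → ℂ} (hf : Differentiable ℂ f) (h0 : f 0 ≠ 0)
    (a : ℂ) : analyticOrderAt f a ≠ ⊤ := by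
  refine AnalyticOnNhd.analyticOrderAt_ne_top_of_isPreconnected (U := Set.univ) (x := 0)
    (fun z _ => hf.analyticAt z) isPreconnected_univ (Set.mem_univ _) (Set.mem_univ _) ?_
  rw [(hf.analyticAt 0).analyticOrderAt_eq_zero.mpr h0]
  simp

/-! ### The zeros of an entire function of order less than two -/

/-- On `|s| = 4r` each linear factor has modulus at least `4r|z i| - 1 ≥ 3`, and the maximum
principle carries the bound on `G` inside. This stands in for Jensen's formula, both in counting
zeros and in bounding the quotient in Hadamard's theorem. -/
theorem three_pow_card_mul_norm_le {κ : Type*} [Fintype κ] {z : κ → ℂ} {r : ℝ} (hr : 0 < r)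
    (hz : ∀ i, 1 ≤ r * ‖z i‖) {G : ℂ → ℂ} (hG : Differentiable ℂ G) {M : ℝ}
    (hM : ∀ s : ℂ, ‖s‖ = 4 * r → ‖(∏ i, (1 - s * z i)) * G s‖ ≤ M) {s : ℂ} (hs : ‖s‖ ≤ 4 * r) :
    3 ^ Fintype.card κ * ‖G s‖ ≤ M := by
  have hr4 : 4 * r ≠ 0 := by positivity
  rw [← le_div_iff₀' (by positivity)]
  refine Complex.norm_le_of_forall_mem_frontier_norm_le (U := Metric.ball 0 (4 * r))
    Metric.isBounded_ball hG.diffContOnCl (fun w hw => ?_)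
    (by rw [closure_ball _ hr4]; simpa using hs)
  rw [frontier_ball _ hr4, mem_sphere_zero_iff_norm] at hw
  rw [le_div_iff₀' (by positivity)]
  refine le_trans ?_ (hM w hw)
  rw [norm_mul, norm_prod]
  gcongr
  rw [← Finset.card_univ, ← Finset.prod_const]
  refine Finset.prod_le_prod (fun _ _ => by norm_num) fun i _ => ?_
  have h1 := norm_sub_norm_le (w * z i) 1
  rw [norm_sub_rev, norm_mul, hw, norm_one] at h1
  have := hz i
  linarith

theorem canonicalProduct_eq_prod_mul_exp {κ : Type*} [Fintype κ] (z : κ → ℂ) (s : ℂ) :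
    canonicalProduct z s = (∏ i, (1 - s * z i)) * Complex.exp (s * ∑ i, z i) := by
  rw [canonicalProduct, tprod_fintype, Finset.prod_mul_distrib, ← Complex.exp_sum,
    Finset.mul_sum]

theorem card_invZeros_fiber {f : ℂ → ℂ} (h0 : f 0 ≠ 0) (a : ℂ) :
    Nat.card {i // a * invZeros f i = 1} = analyticOrderNatAt f a := by
  rw [← card_zeroIndex_fiber]
  exact Nat.card_congr (Equiv.subtypeEquivRight (mul_inv_zeroIndex_eq_one_iff h0 a))

theorem finite_invZeros_fiber {f : ℂ → ℂ} (h0 : f 0 ≠ 0) (a : ℂ) :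
    Finite {i // a * invZeros f i = 1} := by
  have := finite_zeroIndex_fiber f a
  exact Finite.of_equiv _ (Equiv.subtypeEquivRight (mul_inv_zeroIndex_eq_one_iff h0 a)).symm

theorem three_pow_card_zeros_mul_norm_le {f : ℂ → ℂ} (hf : Differentiable ℂ f) (h0 : f 0 ≠ 0)
    {r M : ℝ} (hr : 0 < r) (hM : ∀ s : ℂ, ‖s‖ = 4 * r → ‖f s‖ ≤ M) (S : Finset (ZeroIndex f))
    (hS : ∀ i ∈ S, 1 ≤ r * ‖invZeros f i‖) : 3 ^ S.card * ‖f 0‖ ≤ M := by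
  let z : S → ℂ := fun i => invZeros f i
  have hz : Summable fun i => ‖z i‖ ^ 2 := Summable.of_finite
  have hp := differentiable_canonicalProduct hz
  obtain ⟨q, hq, hfq⟩ := exists_entire_mul_eq hf hp
    (fun a => by rw [analyticOrderAt_canonicalProduct hz]; exact ENat.natCast_ne_top _)
    -- The family over `S` is part of the family of all zeros, so its multiplicities are at most
    -- those of `f`.
    (fun a => by
      have := finite_invZeros_fiber h0 a
      rw [analyticOrderAt_canonicalProduct hz,
        ← Nat.cast_analyticOrderNatAt (analyticOrderAt_ne_top_of_entire hf h0 a),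
        ← card_invZeros_fiber h0 a]
      exact_mod_cast Nat.card_le_card_of_injective
        (fun i : {i : S // a * z i = 1} =>
          (⟨i.1, i.2⟩ : {i // a * invZeros f i = 1}))
        (fun i j h => Subtype.ext (Subtype.ext (congrArg (fun i => i.1) h))))
  have h := three_pow_card_mul_norm_le hr (z := z) (fun i => hS i i.2)
    (G := fun s => Complex.exp (s * ∑ i, z i) * q s) (by fun_prop) (M := M)
    (fun s hs => by
      rw [← mul_assoc, ← canonicalProduct_eq_prod_mul_exp]
      have := hM s hs
      rwa [hfq] at this) (s := 0) (by simpa using hr.le)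
  rw [Fintype.card_coe] at h
  have hf0 : f 0 = q 0 := by
    conv_lhs => rw [hfq]
    rw [Pi.mul_apply, canonicalProduct_zero, one_mul]
  rw [hf0]
  simpa using h

/-- Dyadic decomposition: the terms at scale `2^(-k)` number at most `K x^k` and have squares of
size `4^(-k)` up to a constant, so `x < 4` gives a geometric series. -/
theorem summable_sq_of_card_le {ι : Type*} {b : ι → ℝ} {B K x : ℝ} (hb : ∀ i, 0 < b i)
    (hB : ∀ i, b i ≤ B) (hK : 0 ≤ K) (hx0 : 0 ≤ x) (hx : x < 4)
    (h : ∀ (k : ℕ) (S : Finset ι), (∀ i ∈ S, 1 ≤ 2 ^ k * b i) → (S.card : ℝ) ≤ K * x ^ k) :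
    Summable fun i => b i ^ 2 := by
  classical
  have hex : ∀ i, ∃ k : ℕ, 1 ≤ 2 ^ k * b i ∧ b i ^ 2 ≤ max 4 (B ^ 2) * (1 / 4) ^ k := fun i => by
    have hk : ∃ k : ℕ, 1 ≤ 2 ^ k * b i := by
      obtain ⟨k, hk⟩ := pow_unbounded_of_one_lt (b i)⁻¹ (one_lt_two (α := ℝ))
      exact ⟨k, by
        have := mul_le_mul_of_nonneg_right hk.le (hb i).le
        rwa [inv_mul_cancel₀ (hb i).ne'] at this⟩
    -- Minimality of `k` gives `b i < 2^(1 - k)`, hence the `4` in the maximum; for `k = 0` only `b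
    -- i ≤ B` is available, hence `B²`.
    refine ⟨Nat.find hk, Nat.find_spec hk, ?_⟩
    rcases hn : Nat.find hk with _ | j
    · have := pow_le_pow_left₀ (hb i).le (hB i) 2
      simpa using Or.inr this
    · have hj := Nat.find_min hk (m := j) (by omega)
      rw [not_le] at hj
      have h1 : (2 ^ j * b i) ^ 2 ≤ 1 := pow_le_one₀ (by have := hb i; positivity) hj.le
      have h2 : ((4 : ℝ) ^ j) * b i ^ 2 ≤ 1 := by
        rw [mul_pow, ← pow_mul, mul_comm j 2, pow_mul] at h1
        norm_num at h1
        exact h1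
      have h3 : b i ^ 2 ≤ (1 / 4) ^ j := by
        rw [one_div, inv_pow, ← one_div, le_div_iff₀ (by positivity)]
        linarith
      calc b i ^ 2 ≤ 4 * (1 / 4) ^ (j + 1) := by rw [pow_succ (1 / 4 : ℝ)]; linarith
        _ ≤ _ := by gcongr; exact le_max_left _ _
  choose κ h1 h2 using hex
  have hgeo : Summable fun k : ℕ => (x / 4) ^ k :=
    summable_geometric_of_lt_one (by positivity) (by linarith)
  refine summable_of_sum_le (c := max 4 (B ^ 2) * (K * ∑' k : ℕ, (x / 4) ^ k))
    (fun i => by positivity) fun S => ?_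
  have hm : (0 : ℝ) ≤ max 4 (B ^ 2) := le_trans (by norm_num) (le_max_left _ _)
  calc ∑ i ∈ S, b i ^ 2 ≤ ∑ i ∈ S, max 4 (B ^ 2) * (1 / 4) ^ κ i :=
        Finset.sum_le_sum fun i _ => h2 i
    _ = max 4 (B ^ 2) * ∑ i ∈ S, (1 / 4 : ℝ) ^ κ i := by rw [Finset.mul_sum]
    _ = max 4 (B ^ 2) * ∑ k ∈ S.image κ, ({i ∈ S | κ i = k}.card : ℝ) * (1 / 4 : ℝ) ^ k := by
        rw [Finset.sum_comp (fun k => (1 / 4 : ℝ) ^ k) κ]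
        simp only [nsmul_eq_mul]
    _ ≤ max 4 (B ^ 2) * ∑ k ∈ S.image κ, K * (x / 4) ^ k := by
        refine mul_le_mul_of_nonneg_left (Finset.sum_le_sum fun k _ => ?_) hm
        refine (mul_le_mul_of_nonneg_right (h k _ fun i hi => ?_) (by positivity)).trans_eq ?_
        · rw [← (Finset.mem_filter.mp hi).2]
          exact h1 i
        · rw [mul_assoc, ← mul_pow]
          ring_nf
    _ ≤ _ := by
        rw [← Finset.mul_sum]
        gcongr
        exact hgeo.sum_le_tsum _ fun k _ => by positivity

theorem invZeros_ne_zero {f : ℂ → ℂ} (h0 : f 0 ≠ 0) (i : ZeroIndex f) : invZeros f i ≠ 0 :=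
  inv_ne_zero (zeroIndex_ne_zero h0 i)

theorem summable_norm_invZeros_sq {f : ℂ → ℂ} (hf : Differentiable ℂ f) (h0 : f 0 ≠ 0)
    {C ρ : ℝ} (hC : 0 ≤ C) (hρ0 : 0 ≤ ρ) (hρ : ρ < 2)
    (hgrow : ∀ s, ‖f s‖ ≤ Real.exp (C * (1 + ‖s‖) ^ ρ)) :
    Summable fun i => ‖invZeros f i‖ ^ 2 := by
  obtain ⟨B, hB⟩ := bddAbove_inv_zeros hf h0
  have hx : (2 : ℝ) ^ ρ < 4 := by
    calc (2 : ℝ) ^ ρ < 2 ^ (2 : ℝ) := Real.rpow_lt_rpow_of_exponent_lt one_lt_two hρ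
      _ = 4 := by norm_num
  refine summable_sq_of_card_le (B := B) (K := C * 5 ^ ρ + |Real.log ‖f 0‖|) (x := 2 ^ ρ)
    (fun i => norm_pos_iff.mpr (invZeros_ne_zero h0 i)) (fun i => hB ⟨i, rfl⟩) (by positivity)
    (by positivity) hx fun k S hS => ?_
  have hf0 : 0 < ‖f 0‖ := norm_pos_iff.mpr h0
  -- Taking logarithms bounds the number of zeros in `|s| ≤ 2^k`: `log 3 ≥ 1` removes the base, and
  -- `1 + 4 · 2^k ≤ 5 · 2^k` gives the factor `5^ρ`.
  have h := three_pow_card_zeros_mul_norm_le hf h0 (r := 2 ^ k) (by positivity)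
    (M := Real.exp (C * (1 + 4 * 2 ^ k) ^ ρ)) (fun s hs => by rw [← hs]; exact hgrow s) S hS
  have hlog := Real.log_le_log (by positivity) h
  rw [Real.log_exp, Real.log_mul (by positivity) hf0.ne', Real.log_pow] at hlog
  have h3 : (1 : ℝ) ≤ Real.log 3 := by
    rw [Real.le_log_iff_exp_le (by norm_num)]
    linarith [Real.exp_one_lt_d9]
  have h1 : (S.card : ℝ) ≤ S.card * Real.log 3 := le_mul_of_one_le_right (by positivity) h3
  have h2k : (1 : ℝ) ≤ 2 ^ k := one_le_pow₀ one_le_two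
  have h5 : (1 + 4 * (2 : ℝ) ^ k) ^ ρ ≤ 5 ^ ρ * (2 ^ ρ) ^ k := by
    rw [Real.rpow_pow_comm two_pos.le, ← Real.mul_rpow (by norm_num) (by positivity)]
    gcongr
    linarith
  have h6 : (1 : ℝ) ≤ (2 ^ ρ) ^ k := one_le_pow₀ (Real.one_le_rpow one_le_two hρ0)
  have h7 := neg_abs_le (Real.log ‖f 0‖)
  have h8 : |Real.log ‖f 0‖| ≤ |Real.log ‖f 0‖| * (2 ^ ρ) ^ k :=
    le_mul_of_one_le_right (abs_nonneg _) h6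
  have h9 := mul_le_mul_of_nonneg_left h5 hC
  linarith

/-! ### Hadamard factorization in order less than two -/

/-- The function `h` is the primitive of `q' / q` vanishing at `0`; then `q exp(-h)` has derivative
zero. -/
theorem exists_eq_mul_exp {q : ℂ → ℂ} (hq : Differentiable ℂ q) (hq0 : ∀ s, q s ≠ 0) :
    ∃ h : ℂ → ℂ, Differentiable ℂ h ∧ h 0 = 0 ∧ ∀ s, q s = q 0 * Complex.exp (h s) := by
  have hL : Differentiable ℂ fun s => deriv q s / q s :=
    hq.deriv.div hq hq0
  obtain ⟨h, h00, hh⟩ := hL.isExactOn_univ.with_val_at 0 0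
  have hhd : ∀ s, HasDerivAt h (deriv q s / q s) s := fun s => hh s (Set.mem_univ s)
  refine ⟨h, fun s => (hhd s).differentiableAt, h00, fun s => ?_⟩
  have hconst : ∀ s, HasDerivAt (fun s => q s * Complex.exp (-h s)) 0 s := fun s => by
    have := (hq s).hasDerivAt.mul (hhd s).neg.cexp
    refine this.congr_deriv ?_
    have hqs := hq0 s
    field_simp
    ring
  have := is_const_of_deriv_eq_zero (fun s => (hconst s).differentiableAt)
    (fun s => (hconst s).deriv) s 0
  simp only [h00, neg_zero, Complex.exp_zero, mul_one] at this
  rw [← this, mul_assoc, ← Complex.exp_add, neg_add_cancel, Complex.exp_zero, mul_one]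

/-- Borel–Carathéodory gives `|F| ≤ 2A` on radius `R/2`; Cauchy's estimate on circles of radius
`R/4` gives `2! · 2A / (R/4)² = 64A / R²`. -/
theorem norm_deriv_deriv_le_of_re_le {F : ℂ → ℂ} (hF : Differentiable ℂ F) (hF0 : F 0 = 0)
    {R A : ℝ} (hR : 0 < R) (hA : 0 < A) (hre : ∀ s : ℂ, ‖s‖ ≤ R → (F s).re ≤ A) {w : ℂ}
    (hw : ‖w‖ ≤ R / 4) : ‖deriv (deriv F) w‖ ≤ 64 * A / R ^ 2 := by
  have hbc : ∀ s : ℂ, ‖s‖ ≤ R / 2 → ‖F s‖ ≤ 2 * A := fun s hs => by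
    have h := Complex.borelCaratheodory_zero hA hF.differentiableOn
      (fun s hs => hre s (mem_ball_zero_iff.mp hs).le) hR
      (z := s) (mem_ball_zero_iff.mpr (by linarith)) hF0
    refine h.trans ?_
    rw [div_le_iff₀ (by linarith)]
    nlinarith
  have h := Complex.norm_iteratedDeriv_le_of_forall_mem_sphere_norm_le (c := w) (R := R / 4)
    (C := 2 * A) 2 (by positivity) hF.diffContOnCl fun s hs => hbc s (by
      have h1 : ‖s - w‖ = R / 4 := mem_sphere_iff_norm.mp hs
      have h2 := norm_le_norm_sub_add s w
      linarith)
  rw [iteratedDeriv_succ, iteratedDeriv_one] at h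
  refine h.trans_eq ?_
  rw [Nat.factorial_two]
  field_simp
  norm_num

theorem finite_one_le_mul_norm {ι : Type*} {z : ι → ℂ} (hz : Summable fun i => ‖z i‖ ^ 2)
    (R : ℝ) : {i | 1 ≤ R * ‖z i‖}.Finite := by
  have h1 := hz.tendsto_cofinite_zero.eventually
    (gt_mem_nhds (show (0 : ℝ) < ((|R| + 1)⁻¹) ^ 2 by positivity))
  rw [Filter.eventually_cofinite] at h1
  refine h1.subset fun i (hi : 1 ≤ R * ‖z i‖) => ?_
  have h2 : (|R| + 1)⁻¹ ≤ ‖z i‖ := by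
    rw [inv_le_iff_one_le_mul₀ (by positivity)]
    nlinarith [norm_nonneg (z i), le_abs_self R]
  exact not_lt.mpr (pow_le_pow_left₀ (by positivity) h2 2)

theorem tendsto_rpow_add_div_sq {C D ρ : ℝ} (hC : 0 ≤ C) (hD : 0 ≤ D) (hρ0 : 0 ≤ ρ)
    (hρ : ρ < 2) : Filter.Tendsto (fun n : ℕ => (C * (1 + 8 * (n : ℝ)) ^ ρ + D) / (n : ℝ) ^ 2)
      Filter.atTop (nhds 0) := by
  have h1 := ((tendsto_rpow_neg_atTop (sub_pos.mpr hρ)).comp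
    tendsto_natCast_atTop_atTop).const_mul (C * 9 ^ ρ + D)
  rw [mul_zero] at h1
  refine squeeze_zero' (Filter.Eventually.of_forall fun n => by positivity) ?_ h1
  filter_upwards [Filter.eventually_ge_atTop 1] with n hn
  have hn' : (1 : ℝ) ≤ n := by exact_mod_cast hn
  have hn0 : (0 : ℝ) < n := by linarith
  have h2 : (1 + 8 * (n : ℝ)) ^ ρ ≤ 9 ^ ρ * (n : ℝ) ^ ρ := by
    rw [← Real.mul_rpow (by norm_num) hn0.le]
    gcongr
    linarith
  have h3 : D ≤ D * (n : ℝ) ^ ρ := le_mul_of_one_le_right hD (Real.one_le_rpow hn' hρ0)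
  have h4 := mul_le_mul_of_nonneg_left h2 hC
  rw [Function.comp_apply, neg_sub, Real.rpow_sub hn0, Real.rpow_two, ← mul_div_assoc]
  gcongr
  linarith

/-- The quotient of `f` by its canonical product is `f(0) exp(h)`, and the aim is `h'' = 0`. At
scale `R`, the zeros with `|a| ≤ 2R` are removed by the maximum principle on `|s| = 8R`, and the
product over the rest is at least `exp(-12 R² T)` on `|s| ≤ R`, where `T` is the tail of `∑
|a|^(-2)`. Up to a linear term, `Re h ≤ O(R^ρ) + 12 R² T`, so `h''` is bounded by a multiple of
`o(1) + T`, which tends to `0`. -/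
theorem exists_eq_exp_mul_canonicalProduct {f : ℂ → ℂ} (hf : Differentiable ℂ f) (h0 : f 0 ≠ 0)
    {C ρ : ℝ} (hC : 0 ≤ C) (hρ0 : 0 ≤ ρ) (hρ : ρ < 2)
    (hgrow : ∀ s, ‖f s‖ ≤ Real.exp (C * (1 + ‖s‖) ^ ρ)) :
    ∃ B : ℂ, ∀ s, f s = f 0 * Complex.exp (B * s) * canonicalProduct (invZeros f) s := by
  have hz := summable_norm_invZeros_sq hf h0 hC hρ0 hρ hgrow
  have hP := differentiable_canonicalProduct hz
  have hordP : ∀ a, analyticOrderAt (canonicalProduct (invZeros f)) a = analyticOrderAt f a :=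
    fun a => by
      rw [analyticOrderAt_canonicalProduct hz, card_invZeros_fiber h0,
        Nat.cast_analyticOrderNatAt (analyticOrderAt_ne_top_of_entire hf h0 a)]
  obtain ⟨q, hq, hfq⟩ := exists_entire_mul_eq hf hP
    (fun a => (hordP a).trans_ne (analyticOrderAt_ne_top_of_entire hf h0 a))
    (fun a => (hordP a).le)
  have hfq' : ∀ s, f s = canonicalProduct (invZeros f) s * q s := fun s => congrFun hfq s
  have hqf0 : q 0 = f 0 := by rw [hfq', canonicalProduct_zero, one_mul]
  -- The orders of `f` and of the product are equal and finite, so the order of `q` cancels to `0`.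
  have hq0 : ∀ a, q a ≠ 0 := fun a => by
    have h1 := analyticOrderAt_mul (hP.analyticAt a) (hq.analyticAt a)
    have h2 : analyticOrderAt (canonicalProduct (invZeros f) * q) a = analyticOrderAt f a :=
      congrArg (fun g => analyticOrderAt g a) hfq.symm
    rw [h2, hordP a] at h1
    refine (hq.analyticAt a).analyticOrderAt_eq_zero.mp ?_
    have ht := analyticOrderAt_ne_top_of_entire hf h0 a
    exact ENat.add_left_injective_of_ne_top ht (by simpa [add_comm] using h1.symm)
  obtain ⟨h, hh, hh0, hqh⟩ := exists_eq_mul_exp hq hq0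
  have hf0 : 0 < ‖f 0‖ := norm_pos_iff.mpr h0
  have hfin : ∀ n : ℕ, {i | 1 ≤ 2 * (n : ℝ) * ‖invZeros f i‖}.Finite :=
    fun n => finite_one_le_mul_norm hz _
  have key : ∀ R : ℝ, 1 ≤ R → ∀ S : Set (ZeroIndex f),
      (∀ i, i ∈ S ↔ 1 ≤ 2 * R * ‖invZeros f i‖) → ∀ w : ℂ, ‖w‖ ≤ R / 4 →
      ‖deriv (deriv h) w‖ ≤ 64 * ((C * (1 + 8 * R) ^ ρ + |Real.log ‖f 0‖| + 1) / R ^ 2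
        + 12 * ∑' i : ↥Sᶜ, ‖invZeros f i‖ ^ 2) := by
    intro R hR S hSdef w hw
    have hR0 : 0 < R := by linarith
    have : Finite S := by
      rw [show S = {i | 1 ≤ 2 * R * ‖invZeros f i‖} from Set.ext hSdef]
      exact (finite_one_le_mul_norm hz _).to_subtype
    have : Fintype S := Fintype.ofFinite S
    set T := ∑' i : ↥Sᶜ, ‖invZeros f i‖ ^ 2 with hT
    have hT0 : 0 ≤ T := tsum_nonneg fun i => by positivity
    -- The exponentials of the near factors combine to `exp(s σ)`. No bound on `σ` is needed, since
    -- a linear term disappears in the second derivative.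
    set σ := ∑ i : S, invZeros f i with hσ
    have hzc : Summable fun i : ↥Sᶜ => ‖invZeros f i‖ ^ 2 := hz.subtype Sᶜ
    have hPc := differentiable_canonicalProduct (z := fun i : ↥Sᶜ => invZeros f i) hzc
    have hfac : ∀ s, f s = (∏ i : S, (1 - s * invZeros f i)) *
        (f 0 * Complex.exp (h s + s * σ) *
          canonicalProduct (fun i : ↥Sᶜ => invZeros f i) s) := fun s => by
      rw [hfq' s, canonicalProduct_eq_mul_compl hz S s, canonicalProduct_eq_prod_mul_exp,
        hqh s, hqf0, Complex.exp_add]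
      ring
    have hbound : ∀ s : ℂ, ‖s‖ ≤ 4 * (2 * R) → ‖f 0 * Complex.exp (h s + s * σ) *
        canonicalProduct (fun i : ↥Sᶜ => invZeros f i) s‖ ≤ Real.exp (C * (1 + 8 * R) ^ ρ) := by
      intro s hs
      have h1 := three_pow_card_mul_norm_le (r := 2 * R) (by positivity)
        (z := fun i : S => invZeros f i)
        (fun i => (hSdef i).mp i.2)
        (G := fun s => f 0 * Complex.exp (h s + s * σ) *
          canonicalProduct (fun i : ↥Sᶜ => invZeros f i) s) (by fun_prop)
        (M := Real.exp (C * (1 + 8 * R) ^ ρ)) (fun s hs => by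
          rw [← hfac s]
          refine (hgrow s).trans_eq ?_
          rw [hs]
          ring_nf) hs
      refine le_trans ?_ h1
      exact le_mul_of_one_le_left (norm_nonneg _) (one_le_pow₀ (by norm_num))
    -- The summand `1` only makes the bound strictly positive, as Borel–Carathéodory requires.
    have hre : ∀ s : ℂ, ‖s‖ ≤ R → (h s + s * σ).re
        ≤ C * (1 + 8 * R) ^ ρ + |Real.log ‖f 0‖| + 1 + 12 * R ^ 2 * T := by
      intro s hs
      have h1 := hbound s (by linarith)
      have h2 := exp_neg_le_norm_canonicalProduct (z := fun i : ↥Sᶜ => invZeros f i) hzc (s := s)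
        (fun i => by
          have hi : 2 * R * ‖invZeros f i‖ < 1 := not_le.mp fun h => i.2 ((hSdef i).mpr h)
          rw [norm_mul]
          have := mul_le_mul_of_nonneg_right hs (norm_nonneg (invZeros f i))
          linarith)
      rw [norm_mul, norm_mul, Complex.norm_exp] at h1
      have h3 : ‖f 0‖ * Real.exp (h s + s * σ).re * Real.exp (-(12 * ‖s‖ ^ 2 * T))
          ≤ Real.exp (C * (1 + 8 * R) ^ ρ) :=
        le_trans (mul_le_mul_of_nonneg_left h2 (by positivity)) h1
      have h4 := Real.log_le_log (by positivity) h3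
      rw [Real.log_exp, Real.log_mul (by positivity) (by positivity),
        Real.log_mul (by positivity) (by positivity), Real.log_exp, Real.log_exp] at h4
      have h5 : 12 * ‖s‖ ^ 2 * T ≤ 12 * R ^ 2 * T := by gcongr
      have h6 := neg_abs_le (Real.log ‖f 0‖)
      linarith
    have hF : Differentiable ℂ fun s => h s + s * σ := by fun_prop
    have h1 := norm_deriv_deriv_le_of_re_le hF (by simp [hh0]) hR0
      (A := C * (1 + 8 * R) ^ ρ + |Real.log ‖f 0‖| + 1 + 12 * R ^ 2 * T)
      (by positivity) hre hw
    have h2 : deriv (fun s => h s + s * σ) = fun s => deriv h s + σ := funext fun s => by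
      simpa using ((hh s).hasDerivAt.fun_add ((hasDerivAt_id s).mul_const σ)).deriv
    rw [h2, deriv_add_const] at h1
    refine h1.trans_eq ?_
    field_simp
  have hlim : ∀ w, deriv (deriv h) w = 0 := by
    intro w
    have hA := tendsto_rpow_add_div_sq hC (D := |Real.log ‖f 0‖| + 1) (by positivity) hρ0 hρ
    -- The sets of near zeros exhaust the index set, so the tails `T` tend to zero.
    have hs : Filter.Tendsto (fun n : ℕ => (hfin n).toFinset) Filter.atTop Filter.atTop := by
      refine Filter.tendsto_atTop_finset_of_monotone (fun m n hmn i hi => ?_) fun i => ?_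
      · simp only [Set.Finite.mem_toFinset, Set.mem_ofPred_eq] at hi ⊢
        refine hi.trans ?_
        gcongr
      · have hi := norm_pos_iff.mpr (invZeros_ne_zero h0 i)
        obtain ⟨n, hn⟩ := exists_nat_ge ‖invZeros f i‖⁻¹
        refine ⟨n, ?_⟩
        simp only [Set.Finite.mem_toFinset, Set.mem_ofPred_eq]
        have := mul_le_mul_of_nonneg_right hn hi.le
        rw [inv_mul_cancel₀ hi.ne'] at this
        linarith
    have hB := (tendsto_tsum_compl_atTop_zero fun i => ‖invZeros f i‖ ^ 2).comp hs
    have hlim := ((hA.add (hB.const_mul 12)).const_mul 64)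
    rw [mul_zero, add_zero, mul_zero] at hlim
    refine norm_le_zero_iff.mp (ge_of_tendsto hlim ?_)
    obtain ⟨N, hN⟩ := exists_nat_ge (4 * ‖w‖ + 1)
    filter_upwards [Filter.eventually_ge_atTop N] with n hn
    have hn' : (N : ℝ) ≤ n := by exact_mod_cast hn
    have := norm_nonneg w
    have := key n (by linarith) ((hfin n).toFinset : Set (ZeroIndex f)) (by simp) w (by linarith)
    rw [add_assoc (C * _)] at this
    exact this
  have hB : ∀ s, deriv h s = deriv h 0 := fun s =>
    is_const_of_deriv_eq_zero hh.deriv hlim s 0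
  have hlin : ∀ s, h s = deriv h 0 * s := fun s => by
    have h1 : ∀ s, HasDerivAt (fun s => h s - deriv h 0 * s) 0 s := fun s => by
      have := (hh s).hasDerivAt.sub ((hasDerivAt_id s).const_mul (deriv h 0))
      rw [hB s, mul_one, sub_self] at this
      exact this
    have := is_const_of_deriv_eq_zero (fun s => (h1 s).differentiableAt)
      (fun s => (h1 s).deriv) s 0
    simpa [hh0, sub_eq_zero] using this
  exact ⟨deriv h 0, fun s => by rw [hfq' s, hqh s, hqf0, hlin s]; ring⟩

/-! ### The Weierstrass product of the Gamma function -/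

theorem summable_norm_neg_inv_sq : Summable fun n : ℕ => ‖(-((n : ℂ) + 1)⁻¹)‖ ^ 2 := by
  have h := (summable_nat_add_iff 1).mpr (Real.summable_one_div_nat_pow.mpr one_lt_two)
  refine h.congr fun n => ?_
  have : ‖(n : ℂ) + 1‖ = n + 1 := by
    exact_mod_cast Complex.norm_natCast (n + 1)
  rw [norm_neg, norm_inv, this, inv_pow, one_div]
  push_cast
  rfl

/-- The partial Weierstrass product is the reciprocal of `s` times Euler's approximation to `Γ(s)`,
corrected by `H_n - log n`, whose limit is `γ`. -/
theorem prod_range_one_add_div (s : ℂ) {n : ℕ} (hn : n ≠ 0) (hs : ∀ m : ℕ, s ≠ -m) :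
    ∏ j ∈ Finset.range n, (1 - s * -((j : ℂ) + 1)⁻¹) * Complex.exp (s * -((j : ℂ) + 1)⁻¹)
      = Complex.exp (-s * ((harmonic n : ℝ) - Real.log n : ℝ)) / (s * Complex.GammaSeq s n) := by
  have hs0 : s ≠ 0 := by simpa using hs 0
  have hn0 : (n : ℂ) ≠ 0 := by exact_mod_cast hn
  have hfac : ((n.factorial : ℕ) : ℂ) = ∏ j ∈ Finset.range n, ((j : ℂ) + 1) := by
    rw [← Finset.prod_range_add_one_eq_factorial]
    push_cast
    rfl
  have hf0 : ((n.factorial : ℕ) : ℂ) ≠ 0 := by exact_mod_cast n.factorial_ne_zero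
  have hprod : ∏ j ∈ Finset.range n, (1 - s * -((j : ℂ) + 1)⁻¹)
      = (∏ j ∈ Finset.range n, (s + (j + 1 : ℕ))) / n.factorial := by
    rw [hfac, ← Finset.prod_div_distrib]
    refine Finset.prod_congr rfl fun j _ => ?_
    have : (j : ℂ) + 1 ≠ 0 := by exact_mod_cast j.succ_ne_zero
    push_cast
    field_simp
    ring
  have hp0 : ∏ j ∈ Finset.range n, (s + (j + 1 : ℕ)) ≠ 0 :=
    Finset.prod_ne_zero_iff.mpr fun j _ h => hs (j + 1) (eq_neg_of_add_eq_zero_left h)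
  have hexp : ∏ j ∈ Finset.range n, Complex.exp (s * -((j : ℂ) + 1)⁻¹)
      = Complex.exp (-s * (harmonic n : ℝ)) := by
    rw [← Complex.exp_sum, ← Finset.mul_sum, harmonic]
    push_cast
    rw [Finset.sum_neg_distrib]
    ring_nf
  rw [Finset.prod_mul_distrib, hexp, hprod, Complex.GammaSeq, Finset.prod_range_succ',
    Complex.cpow_def_of_ne_zero hn0, ← Complex.natCast_log]
  have e : Complex.exp (-s * ((harmonic n : ℝ) - Real.log n : ℝ))
      = Complex.exp (-s * (harmonic n : ℝ)) * Complex.exp (Real.log n * s) := by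
    rw [← Complex.exp_add]
    push_cast
    ring_nf
  rw [e]
  have := Complex.exp_ne_zero (Real.log n * s)
  simp only [Nat.cast_zero, add_zero]
  field_simp

theorem recipGamma_eq_exp_mul_canonicalProduct (s : ℂ) :
    recipGamma s = 1 * Complex.exp (Real.eulerMascheroniConstant * s) *
      canonicalProduct (fun n : ℕ => -((n : ℂ) + 1)⁻¹) s := by
  rcases eq_or_ne s 0 with rfl | hs0
  · simp [recipGamma, canonicalProduct_zero]
  by_cases hs : ∀ m : ℕ, s ≠ -m
  · have h1 := (multipliable_canonicalFactor summable_norm_neg_inv_sq s).hasProd.tendsto_prod_nat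
    have hG : s * Complex.Gamma s ≠ 0 := mul_ne_zero hs0 (Complex.Gamma_ne_zero hs)
    have h2 : Filter.Tendsto (fun n : ℕ =>
        Complex.exp (-s * ((harmonic n : ℝ) - Real.log n : ℝ)) / (s * Complex.GammaSeq s n))
        Filter.atTop (nhds (Complex.exp (-s * (Real.eulerMascheroniConstant : ℝ))
          / (s * Complex.Gamma s))) := by
      refine Filter.Tendsto.div ?_ ((Complex.GammaSeq_tendsto_Gamma s).const_mul s) hG
      exact (Complex.continuous_exp.tendsto _).comp
        (((Complex.continuous_ofReal.tendsto _).comp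
          Real.tendsto_harmonic_sub_log).const_mul (-s))
    have h3 := tendsto_nhds_unique (h1.congr' (by
      filter_upwards [Filter.eventually_ne_atTop 0] with n hn
      exact prod_range_one_add_div s hn hs)) h2
    rw [canonicalProduct, h3, recipGamma_eq hs0, one_mul, ← mul_div_assoc, ← Complex.exp_add]
    congr 1
    rw [eq_comm, Complex.exp_eq_one_iff]
    exact ⟨0, by push_cast; ring⟩
  -- At a negative integer one factor of the product vanishes, and so does `recipGamma`: `Γ` has
  -- default value `0` at its poles, and `0⁻¹ = 0`.
  · push Not at hs
    obtain ⟨m, rfl⟩ := hs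
    have hm : m ≠ 0 := by
      rintro rfl
      simp at hs0
    obtain ⟨k, rfl⟩ := Nat.exists_eq_succ_of_ne_zero hm
    have hk : (k : ℂ) + 1 ≠ 0 := by exact_mod_cast k.succ_ne_zero
    rw [canonicalProduct, tprod_of_exists_eq_zero ⟨k, by
      push_cast
      field_simp
      simp⟩, mul_zero, recipGamma]
    rw [show (-((k.succ : ℕ) : ℂ) + 1) = -(k : ℂ) by push_cast; ring, Complex.Gamma_neg_nat_eq_zero,
      inv_zero]

/-! ### Growth of the function `ξ` -/

theorem norm_Gamma_le_Gamma_re {s : ℂ} (hs : 0 < s.re) :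
    ‖Complex.Gamma s‖ ≤ Real.Gamma s.re := by
  rw [Complex.Gamma_eq_integral hs, Real.Gamma_eq_integral hs, Complex.GammaIntegral]
  refine (MeasureTheory.norm_integral_le_integral_norm _).trans_eq ?_
  refine MeasureTheory.setIntegral_congr_fun measurableSet_Ioi fun x hx => ?_
  have hx0 : 0 < x := hx
  simp only [norm_mul, Complex.norm_real, Real.norm_eq_abs, Real.abs_exp]
  rw [Complex.norm_cpow_eq_rpow_re_of_pos hx0]
  simp

/-- `Γ(x) ≤ n! ≤ exp(n log n)` with `n = ⌈x⌉`, and `log y ≤ 2 √y`. Any exponent below `2` would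
serve Hadamard's theorem; `3/2` is convenient. -/
theorem Gamma_le_exp_rpow {x y : ℝ} (hx : 2 ≤ x) (hxy : x + 1 ≤ y) :
    Real.Gamma x ≤ Real.exp (2 * y ^ (3 / 2 : ℝ)) := by
  have hy : 0 < y := by linarith
  set n := ⌈x⌉₊ with hn
  have hn1 : x ≤ n := Nat.le_ceil x
  have hn2 : (n : ℝ) < x + 1 := Nat.ceil_lt_add_one (by linarith)
  have hn0 : (0 : ℝ) < n := by linarith
  have h1 : Real.Gamma x ≤ Real.Gamma (n + 1) :=
    Real.Gamma_strictMonoOn_Ici.monotoneOn (Set.mem_Ici.mpr hx)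
      (Set.mem_Ici.mpr (by linarith)) (by linarith)
  rw [Real.Gamma_nat_eq_factorial] at h1
  have h2 : (n.factorial : ℝ) ≤ (n : ℝ) ^ n := by exact_mod_cast n.factorial_le_pow
  have h3 : (n : ℝ) ^ n = Real.exp (n * Real.log n) := by
    rw [mul_comm, Real.exp_mul, Real.exp_log hn0, Real.rpow_natCast]
  have h4 : Real.log n ≤ 2 * y ^ (1 / 2 : ℝ) := by
    have h5 : Real.log n ≤ Real.log y := Real.log_le_log hn0 (by linarith)
    have h6 := Real.log_le_rpow_div hy.le (show (0 : ℝ) < 1 / 2 by norm_num)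
    linarith
  rw [h3] at h2
  refine (h1.trans h2).trans (Real.exp_le_exp.mpr ?_)
  calc (n : ℝ) * Real.log n ≤ y * (2 * y ^ (1 / 2 : ℝ)) := by
        have : (n : ℝ) ≤ y := by linarith
        gcongr
    _ = 2 * (y ^ (1 : ℝ) * y ^ (1 / 2 : ℝ)) := by rw [Real.rpow_one]; ring
    _ = _ := by rw [← Real.rpow_add hy]; norm_num

theorem norm_riemannZeta_le {s : ℂ} (hs : 2 ≤ s.re) :
    ‖riemannZeta s‖ ≤ ∑' n : ℕ, 1 / ((n : ℝ) + 1) ^ 2 := by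
  have hsum : Summable fun n : ℕ => 1 / ((n : ℝ) + 1) ^ 2 := by
    exact_mod_cast (summable_nat_add_iff 1).mpr (Real.summable_one_div_nat_pow.mpr one_lt_two)
  rw [zeta_eq_tsum_one_div_nat_add_one_cpow (by linarith)]
  refine tsum_of_norm_bounded hsum.hasSum fun n => ?_
  have hn : (1 : ℝ) ≤ n + 1 := by linarith [n.cast_nonneg (α := ℝ)]
  rw [norm_div, norm_one, show (n : ℂ) + 1 = ((n + 1 : ℝ) : ℂ) by push_cast; rfl,
    Complex.norm_cpow_eq_rpow_re_of_pos (by linarith)]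
  gcongr
  rw [← Real.rpow_two]
  exact Real.rpow_le_rpow_of_exponent_le hn hs

/-- `Λ₀(s)` is half a Mellin transform at `s/2`, absolutely convergent everywhere. For `0 ≤ Re s ≤
4` the exponent of `t` lies between `-1` and `1`, so the integrals at the two ends of the strip
dominate. -/
theorem exists_norm_completedRiemannZeta₀_le_of_re_mem :
    ∃ K : ℝ, ∀ s : ℂ, 0 ≤ s.re → s.re ≤ 4 → ‖completedRiemannZeta₀ s‖ ≤ K := by
  set P := HurwitzZeta.hurwitzEvenFEPair 0
  have hconv : ∀ s, MellinConvergent P.f_modif s := fun s =>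
    (P.isStrongFEPair_toStrongFEPair.hasMellin s).1
  have h0 := (hconv 0).norm
  have h2 := (hconv 2).norm
  refine ⟨(∫ t in Set.Ioi (0 : ℝ), (‖(t : ℂ) ^ ((0 : ℂ) - 1) • P.f_modif t‖
    + ‖(t : ℂ) ^ ((2 : ℂ) - 1) • P.f_modif t‖)) / 2, fun s hs0 hs4 => ?_⟩
  have e : completedRiemannZeta₀ s = mellin P.f_modif (s / 2) / 2 := rfl
  rw [e, norm_div, Complex.norm_ofNat]
  gcongr
  rw [mellin]
  refine (MeasureTheory.norm_integral_le_integral_norm _).trans ?_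
  refine MeasureTheory.setIntegral_mono_on (hconv (s / 2)).norm (h0.add h2) measurableSet_Ioi
    fun t ht => ?_
  have ht0 : 0 < t := ht
  rw [norm_smul, norm_smul, norm_smul, ← add_mul]
  gcongr
  rw [Complex.norm_cpow_eq_rpow_re_of_pos ht0, Complex.norm_cpow_eq_rpow_re_of_pos ht0,
    Complex.norm_cpow_eq_rpow_re_of_pos ht0]
  have e1 : (s / 2 - 1).re = s.re / 2 - 1 := by simp
  have e2 : ((0 : ℂ) - 1).re = -1 := by simp
  have e3 : ((2 : ℂ) - 1).re = 1 := by simp; norm_num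
  rw [e1, e2, e3]
  rcases le_total t 1 with h | h
  · have := Real.rpow_le_rpow_of_exponent_ge ht0 h (show -1 ≤ s.re / 2 - 1 by linarith)
    exact this.trans (le_add_of_nonneg_right (Real.rpow_nonneg ht0.le 1))
  · have := Real.rpow_le_rpow_of_exponent_le h (show s.re / 2 - 1 ≤ 1 by linarith)
    exact this.trans (le_add_of_nonneg_left (Real.rpow_nonneg ht0.le (-1)))

/-- For `Re s ≥ 4` the bounds on `Γ` and `ζ` apply; the left half-plane follows from `s ↦ 1 - s`,
where `1 + |1 - s| ≤ 2(1 + |s|)` and `2^(3/2) ≤ 3` turn the constant `2` into `6`. -/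
theorem exists_norm_completedRiemannZeta₀_le :
    ∃ K : ℝ, 0 ≤ K ∧ ∀ s : ℂ,
      ‖completedRiemannZeta₀ s‖ ≤ K * Real.exp (6 * (1 + ‖s‖) ^ (3 / 2 : ℝ)) := by
  obtain ⟨K, hK⟩ := exists_norm_completedRiemannZeta₀_le_of_re_mem
  have hK0 : 0 ≤ K := (norm_nonneg _).trans (hK 0 (by simp) (by simp))
  set Z := ∑' n : ℕ, 1 / ((n : ℝ) + 1) ^ 2 with hZ
  have hZ0 : 0 ≤ Z := tsum_nonneg fun n => by positivity
  have hright : ∀ s : ℂ, 0 ≤ s.re → ‖completedRiemannZeta₀ s‖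
      ≤ (K + Z + 2) * Real.exp (2 * (1 + ‖s‖) ^ (3 / 2 : ℝ)) := by
    intro s hs0
    have hE : 1 ≤ Real.exp (2 * (1 + ‖s‖) ^ (3 / 2 : ℝ)) := Real.one_le_exp (by positivity)
    rcases le_total s.re 4 with hs4 | hs4
    · refine (hK s hs0 hs4).trans ?_
      nlinarith
    have hre := Complex.re_le_norm s
    have hs0' : s ≠ 0 := by rintro rfl; norm_num at hs4
    have hG0 : Complex.Gammaℝ s ≠ 0 := Complex.Gammaℝ_ne_zero_of_re_pos (by linarith)
    have h1 := completedRiemannZeta_eq s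
    have h2 := riemannZeta_def_of_ne_zero hs0'
    have h3 : completedRiemannZeta₀ s
        = Complex.Gammaℝ s * riemannZeta s + 1 / s + 1 / (1 - s) := by
      rw [h2, mul_div_cancel₀ _ hG0, h1]
      ring
    have h4 : ‖Complex.Gammaℝ s‖ ≤ Real.exp (2 * (1 + ‖s‖) ^ (3 / 2 : ℝ)) := by
      have e1 : (s / 2).re = s.re / 2 := by simp
      have e2 : ‖(Real.pi : ℂ) ^ (-s / 2)‖ ≤ 1 := by
        rw [Complex.norm_cpow_eq_rpow_re_of_pos Real.pi_pos]
        refine Real.rpow_le_one_of_one_le_of_nonpos (by linarith [Real.pi_gt_three]) ?_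
        rw [neg_div, Complex.neg_re, e1]
        linarith
      have e3 : ‖Complex.Gamma (s / 2)‖ ≤ Real.exp (2 * (1 + ‖s‖) ^ (3 / 2 : ℝ)) := by
        refine (norm_Gamma_le_Gamma_re (by rw [e1]; linarith)).trans ?_
        rw [e1]
        exact Gamma_le_exp_rpow (by linarith) (by linarith)
      rw [Complex.Gammaℝ_def, norm_mul]
      calc _ ≤ 1 * Real.exp (2 * (1 + ‖s‖) ^ (3 / 2 : ℝ)) := by gcongr
        _ = _ := one_mul _
    have h5 : ‖(1 : ℂ) / s‖ ≤ 1 := by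
      rw [norm_div, norm_one, div_le_one (norm_pos_iff.mpr hs0')]
      linarith
    have h6 : ‖(1 : ℂ) / (1 - s)‖ ≤ 1 := by
      have : 1 ≤ ‖1 - s‖ := by
        have := Complex.abs_re_le_norm (1 - s)
        rw [Complex.sub_re, Complex.one_re, abs_of_nonpos (by linarith)] at this
        linarith
      rw [norm_div, norm_one, div_le_one (by linarith)]
      exact this
    rw [h3]
    refine (norm_add₃_le).trans ?_
    rw [norm_mul]
    have h7 := mul_le_mul h4 (norm_riemannZeta_le (s := s) (by linarith)) (norm_nonneg _)
      (by positivity)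
    nlinarith
  refine ⟨K + Z + 2, by positivity, fun s => ?_⟩
  rcases le_total 0 s.re with hs | hs
  · refine (hright s hs).trans ?_
    gcongr
    norm_num
  · rw [← completedRiemannZeta₀_one_sub]
    refine (hright (1 - s) (by simp; linarith)).trans ?_
    refine mul_le_mul_of_nonneg_left (Real.exp_le_exp.mpr ?_) (by positivity)
    have h1 : 1 + ‖1 - s‖ ≤ 2 * (1 + ‖s‖) := by
      have := norm_sub_le 1 s
      rw [norm_one] at this
      linarith [norm_nonneg s]
    have h2 : (2 : ℝ) ^ (3 / 2 : ℝ) ≤ 3 := by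
      rw [show (3 / 2 : ℝ) = 1 + 1 / 2 by norm_num, Real.rpow_add two_pos, Real.rpow_one,
        ← Real.sqrt_eq_rpow]
      nlinarith [Real.sqrt_nonneg 2, Real.sq_sqrt (show (0 : ℝ) ≤ 2 by norm_num)]
    calc 2 * (1 + ‖1 - s‖) ^ (3 / 2 : ℝ) ≤ 2 * (2 * (1 + ‖s‖)) ^ (3 / 2 : ℝ) := by gcongr
      _ = 2 * (2 ^ (3 / 2 : ℝ) * (1 + ‖s‖) ^ (3 / 2 : ℝ)) := by
        rw [Real.mul_rpow two_pos.le (by positivity)]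
      _ ≤ 2 * (3 * (1 + ‖s‖) ^ (3 / 2 : ℝ)) := by gcongr
      _ = _ := by ring

theorem exists_norm_xiFunction_le :
    ∃ C : ℝ, 0 ≤ C ∧ ∀ s : ℂ, ‖xiFunction s‖ ≤ Real.exp (C * (1 + ‖s‖) ^ (3 / 2 : ℝ)) := by
  obtain ⟨K, hK0, hK⟩ := exists_norm_completedRiemannZeta₀_le
  -- The summands absorb the constant `K + 1`, the factor `(1 + |s|)²` and the growth of `Λ₀`.
  refine ⟨K + 1 + 2 + 6, by positivity, fun s => ?_⟩
  set y := 1 + ‖s‖ with hy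
  have hy1 : 1 ≤ y := by linarith [norm_nonneg s]
  set Y := y ^ (3 / 2 : ℝ) with hY
  have hyY : y ≤ Y := by
    simpa using Real.rpow_le_rpow_of_exponent_le hy1 (show (1 : ℝ) ≤ 3 / 2 by norm_num)
  have h1 : y ^ 2 ≤ Real.exp (2 * Y) := by
    rw [two_mul, Real.exp_add, ← sq]
    gcongr
    linarith [Real.add_one_le_exp Y]
  have h2 : K + 1 ≤ Real.exp ((K + 1) * Y) := by
    have := Real.add_one_le_exp ((K + 1) * Y)
    nlinarith
  have h3 : ‖s * (s - 1)‖ ≤ y ^ 2 := by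
    rw [norm_mul, sq]
    have := norm_sub_le s 1
    rw [norm_one] at this
    gcongr
    · linarith
    · linarith
  have hE : 1 ≤ Real.exp (6 * Y) := Real.one_le_exp (by positivity)
  have h4 : ‖s * (s - 1) * completedRiemannZeta₀ s + 1‖ ≤ (K + 1) * y ^ 2 * Real.exp (6 * Y) := by
    refine (norm_add_le _ _).trans ?_
    rw [norm_mul, norm_one]
    have h5 := mul_le_mul h3 (hK s) (norm_nonneg _) (by positivity)
    have h6 : 1 ≤ y ^ 2 * Real.exp (6 * Y) := one_le_mul_of_one_le_of_one_le (one_le_pow₀ hy1) hE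
    linarith
  rw [xiFunction, norm_div, Complex.norm_ofNat]
  calc _ ≤ ‖s * (s - 1) * completedRiemannZeta₀ s + 1‖ := half_le_self (norm_nonneg _)
    _ ≤ (K + 1) * y ^ 2 * Real.exp (6 * Y) := h4
    _ ≤ Real.exp ((K + 1) * Y) * Real.exp (2 * Y) * Real.exp (6 * Y) := by gcongr
    _ = _ := by rw [← Real.exp_add, ← Real.exp_add]; ring_nf

/-! ### The three factors -/

theorem canonicalProduct_invZeros_recipGamma (s : ℂ) :
    canonicalProduct (invZeros recipGamma) s
      = Complex.exp (-(Real.eulerMascheroniConstant * s)) * recipGamma s := by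
  rw [(canonicalProduct_invZeros_of_eq
    (fun n => neg_ne_zero.mpr (inv_ne_zero (Nat.cast_add_one_ne_zero n)))
    summable_norm_neg_inv_sq one_ne_zero recipGamma_eq_exp_mul_canonicalProduct).2,
    recipGamma_eq_exp_mul_canonicalProduct, one_mul, ← mul_assoc, ← Complex.exp_add,
    neg_add_cancel, Complex.exp_zero, one_mul]

theorem summable_norm_invZeros_recipGamma_sq :
    Summable fun i => ‖invZeros recipGamma i‖ ^ 2 := by
  obtain ⟨e, he⟩ := (canonicalProduct_invZeros_of_eq
    (fun n => neg_ne_zero.mpr (inv_ne_zero (Nat.cast_add_one_ne_zero n)))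
    summable_norm_neg_inv_sq one_ne_zero recipGamma_eq_exp_mul_canonicalProduct).1
  exact ((e.summable_iff).mpr summable_norm_neg_inv_sq).congr fun i => by
    rw [Function.comp_apply, he]

theorem exists_equiv_zeroIndex_phiFunction :
    ∃ _ : ZeroIndex phiFunction ≃ Unit, ∀ i, (1 : ℂ) = invZeros phiFunction i :=
  (canonicalProduct_invZeros_of_eq (ι := Unit) (z := fun _ => 1) (c := 1) (B := -1)
    (fun _ => one_ne_zero) Summable.of_finite one_ne_zero fun s => by
      rw [canonicalProduct_eq_prod_mul_exp]
      simp only [Finset.univ_unique, Finset.prod_singleton, Finset.sum_singleton, mul_one, one_mul]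
      rw [mul_comm (1 - s), ← mul_assoc, ← Complex.exp_add]
      simp [phiFunction]).1

theorem summable_norm_invZeros_xiFunction_sq :
    Summable fun i => ‖invZeros xiFunction i‖ ^ 2 := by
  obtain ⟨C, hC, h⟩ := exists_norm_xiFunction_le
  exact summable_norm_invZeros_sq differentiable_xiFunction xiFunction_zero_ne hC (by norm_num)
    (by norm_num) h

theorem hasDerivAt_xiFunction_zero :
    HasDerivAt xiFunction (-completedRiemannZeta₀ 0 / 2) 0 := by
  have h := ((((hasDerivAt_id (0 : ℂ)).mul ((hasDerivAt_id (0 : ℂ)).sub_const 1)).mul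
    (differentiable_completedZeta₀ 0).hasDerivAt).add_const 1).div_const 2
  refine h.congr_deriv ?_
  simp

theorem xiFunction_eq_exp_mul_canonicalProduct (s : ℂ) :
    xiFunction s = 1 / 2 * Complex.exp (-completedRiemannZeta₀ 0 * s) *
      canonicalProduct (invZeros xiFunction) s := by
  obtain ⟨C, hC, h⟩ := exists_norm_xiFunction_le
  obtain ⟨B, hB⟩ := exists_eq_exp_mul_canonicalProduct differentiable_xiFunction
    xiFunction_zero_ne hC (by norm_num) (by norm_num) h
  have hx0 : xiFunction 0 = 1 / 2 := by simp [xiFunction]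
  have hz := summable_norm_invZeros_xiFunction_sq
  -- The canonical product contributes value `1` and derivative `0`, so comparing derivatives of `ξ`
  -- at `0` determines `B`.
  have hd : HasDerivAt xiFunction (B / 2) 0 := by
    rw [funext hB]
    refine ((((hasDerivAt_id (0 : ℂ)).const_mul B).cexp.const_mul (xiFunction 0)).mul
      (differentiable_canonicalProduct hz 0).hasDerivAt).congr_deriv ?_
    simp [deriv_canonicalProduct_zero hz, canonicalProduct_zero, hx0]
    ring
  have hB' : B = -completedRiemannZeta₀ 0 := by
    have := hd.unique hasDerivAt_xiFunction_zero
    linear_combination 2 * this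
  rw [hB s, hx0, hB']

theorem xiFunction_one_sub (s : ℂ) : xiFunction (1 - s) = xiFunction s := by
  rw [xiFunction, xiFunction, completedRiemannZeta₀_one_sub]
  ring

theorem riemannZeta_eq_xiFunction {s : ℂ} (hs : s ≠ 1) :
    riemannZeta s = -(xiFunction s * (Real.pi : ℂ) ^ (s / 2) * recipGamma (s / 2)) / (1 - s) := by
  have h1 : 1 - s ≠ 0 := sub_ne_zero.mpr hs.symm
  rw [riemannZeta_eq_mul_completedRiemannZeta₀, recipGamma, xiFunction, neg_div 2 s,
    Complex.cpow_neg]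
  have hpi : (Real.pi : ℂ) ^ (s / 2) ≠ 0 := by
    simp [Complex.cpow_eq_zero_iff, Real.pi_ne_zero]
  rw [← div_eq_mul_inv _ (Complex.Gamma _)]
  -- `Γ` is zero only by default, at its poles; both sides then vanish.
  rcases eq_or_ne (Complex.Gamma (s / 2 + 1)) 0 with hG | hG
  · simp [hG]
  field_simp
  ring

theorem riemannZeta_eq_canonicalProduct {s : ℂ} (hs : s ≠ 1) :
    riemannZeta s = -(Complex.exp (((Real.log (2 * Real.pi) - 1 : ℝ) : ℂ) * s) / 2) *
      (canonicalProduct (invZeros recipGamma) (s / 2) * canonicalProduct (invZeros xiFunction) s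
        / (1 - s)) := by
  have hpi : (Real.pi : ℂ) ≠ 0 := by exact_mod_cast Real.pi_ne_zero
  rw [riemannZeta_eq_xiFunction hs, xiFunction_eq_exp_mul_canonicalProduct,
    canonicalProduct_invZeros_recipGamma, Complex.cpow_def_of_ne_zero hpi,
    ← Complex.ofReal_log Real.pi_pos.le, completedRiemannZeta₀_zero,
    show (4 * Real.pi : ℂ) = ((4 * Real.pi : ℝ) : ℂ) by push_cast; rfl,
    ← Complex.ofReal_log (by positivity)]
  have e4 : Real.log (4 * Real.pi) = 2 * Real.log 2 + Real.log Real.pi := by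
    rw [Real.log_mul (by norm_num) Real.pi_ne_zero, show (4 : ℝ) = 2 ^ 2 by norm_num,
      Real.log_pow]
    norm_num
  have e2 : Real.log (2 * Real.pi) = Real.log 2 + Real.log Real.pi :=
    Real.log_mul (by norm_num) Real.pi_ne_zero
  -- Here `γ` cancels, and `½ log 4π + ½ log π = log 2π`.
  have hexp : Complex.exp (-(((Real.eulerMascheroniConstant : ℂ)
        - (Real.log (4 * Real.pi) : ℝ)) / 2 + 1) * s) * Complex.exp ((Real.log Real.pi : ℝ) * (s / 2))
      = Complex.exp (((Real.log (2 * Real.pi) - 1 : ℝ) : ℂ) * s)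
        * Complex.exp (-(Real.eulerMascheroniConstant * (s / 2))) := by
    rw [← Complex.exp_add, ← Complex.exp_add, e4, e2]
    push_cast
    ring_nf
  linear_combination (-(1 / 2) * canonicalProduct (invZeros xiFunction) s
    * recipGamma (s / 2) / (1 - s)) * hexp

/-! ### Location of the zeros and orders of vanishing -/

theorem recipGamma_half_eq_zero_iff (s : ℂ) :
    recipGamma (s / 2) = 0 ↔ ∃ n : ℕ, s = -2 * (n + 1) := by
  rw [recipGamma, inv_eq_zero, Complex.Gamma_eq_zero_iff]
  constructor
  · rintro ⟨m, hm⟩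
    exact ⟨m, by linear_combination 2 * hm⟩
  · rintro ⟨m, rfl⟩
    exact ⟨m, by ring⟩

theorem recipGamma_half_ne_zero_of_re_pos {s : ℂ} (hs : 0 < s.re) : recipGamma (s / 2) ≠ 0 := by
  rw [Ne, recipGamma_half_eq_zero_iff]
  rintro ⟨n, rfl⟩
  have : (-2 * ((n : ℂ) + 1)).re = -2 * ((n : ℝ) + 1) := by simp
  rw [this] at hs
  linarith [n.cast_nonneg (α := ℝ)]

theorem xiFunction_ne_zero_of_one_le_re {s : ℂ} (hs : 1 ≤ s.re) : xiFunction s ≠ 0 := by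
  rcases eq_or_ne s 1 with rfl | h1
  · simp [xiFunction]
  intro h
  have := riemannZeta_eq_xiFunction h1
  rw [h, zero_mul, zero_mul, neg_zero, zero_div] at this
  exact riemannZeta_ne_zero_of_one_le_re hs this

theorem xiFunction_ne_zero_of_re_nonpos {s : ℂ} (hs : s.re ≤ 0) : xiFunction s ≠ 0 := by
  rw [← xiFunction_one_sub]
  exact xiFunction_ne_zero_of_one_le_re (by simp; linarith)

theorem xiFunction_eq_zero_iff (s : ℂ) :
    xiFunction s = 0 ↔ riemannZeta s = 0 ∧ 0 < s.re ∧ s.re < 1 := by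
  have hstrip : 0 < s.re → s.re < 1 → (xiFunction s = 0 ↔ riemannZeta s = 0) := fun h0 h1 => by
    have hs : s ≠ 1 := by rintro rfl; simp at h1
    have h1s : 1 - s ≠ 0 := sub_ne_zero.mpr hs.symm
    rw [riemannZeta_eq_xiFunction hs, div_eq_zero_iff, neg_eq_zero]
    simp [recipGamma_half_ne_zero_of_re_pos h0, h1s, Complex.cpow_eq_zero_iff, Real.pi_ne_zero]
  constructor
  · intro h
    have h0 : 0 < s.re := by
      by_contra hn
      exact xiFunction_ne_zero_of_re_nonpos (not_lt.mp hn) h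
    have h1 : s.re < 1 := by
      by_contra hn
      exact xiFunction_ne_zero_of_one_le_re (not_lt.mp hn) h
    exact ⟨(hstrip h0 h1).mp h, h0, h1⟩
  · rintro ⟨h, h0, h1⟩
    exact (hstrip h0 h1).mpr h

theorem canonicalProduct_xi_eq_zero_iff (s : ℂ) :
    canonicalProduct (invZeros xiFunction) s = 0 ↔ xiFunction s = 0 := by
  rw [xiFunction_eq_exp_mul_canonicalProduct]
  simp [Complex.exp_ne_zero]

theorem canonicalProduct_recipGamma_eq_zero_iff (s : ℂ) :
    canonicalProduct (invZeros recipGamma) s = 0 ↔ recipGamma s = 0 := by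
  rw [canonicalProduct_invZeros_recipGamma]
  simp [Complex.exp_ne_zero]

theorem analyticOrderAt_riemannZeta_eq {F u : ℂ → ℂ} (hF : Differentiable ℂ F)
    (hu : DifferentiableOn ℂ u {1}ᶜ) (h : ∀ s, s ≠ 1 → riemannZeta s = F s * u s) {a : ℂ}
    (ha : a ≠ 1) (hua : u a ≠ 0) : analyticOrderAt F a = analyticOrderAt riemannZeta a := by
  have hmem : ({1}ᶜ : Set ℂ) ∈ nhds a := isOpen_compl_singleton.mem_nhds ha
  have hua' : AnalyticAt ℂ u a := hu.analyticAt hmem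
  have hev : riemannZeta =ᶠ[nhds a] F * u := by
    filter_upwards [hmem] with s hs using h s hs
  rw [analyticOrderAt_congr hev, analyticOrderAt_mul (hF.analyticAt a) hua',
    hua'.analyticOrderAt_eq_zero.mpr hua, add_zero]

theorem meromorphicOrderAt_riemannZeta_one : meromorphicOrderAt riemannZeta 1 = -1 := by
  let g : ℂ → ℂ := fun s => xiFunction s * (Real.pi : ℂ) ^ (s / 2) * recipGamma (s / 2)
  have hpi : (Real.pi : ℂ) ≠ 0 := by exact_mod_cast Real.pi_ne_zero
  have hg : Differentiable ℂ g := by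
    have h1 := differentiable_xiFunction
    have h2 := differentiable_recipGamma
    have h3 : Differentiable ℂ fun s : ℂ => (Real.pi : ℂ) ^ (s / 2) := fun s =>
      (differentiableAt_id.div_const 2).const_cpow (Or.inl hpi)
    exact (h1.mul h3).mul (h2.comp (differentiable_id.div_const 2))
  have hg1 : g 1 ≠ 0 := by
    refine mul_ne_zero (mul_ne_zero (xiFunction_ne_zero_of_one_le_re (by simp)) ?_)
      (recipGamma_half_ne_zero_of_re_pos (by simp))
    simp [Complex.cpow_eq_zero_iff, Real.pi_ne_zero]
  have hev : ∀ᶠ s in nhdsWithin (1 : ℂ) {1}ᶜ, riemannZeta s = (s - 1) ^ (-1 : ℤ) • g s := by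
    filter_upwards [self_mem_nhdsWithin] with s hs
    have hs1 : s ≠ 1 := hs
    have h1 : s - 1 ≠ 0 := sub_ne_zero.mpr hs1
    rw [riemannZeta_eq_xiFunction hs1, zpow_neg_one, smul_eq_mul, ← neg_sub s 1, neg_div_neg_eq,
      div_eq_inv_mul]
  have hm : MeromorphicAt (fun s : ℂ => (s - 1) ^ (-1 : ℤ) • g s) 1 :=
    (((analyticAt_id.sub analyticAt_const).meromorphicAt).zpow (-1)).smul
      (hg.analyticAt 1).meromorphicAt
  have hz : MeromorphicAt riemannZeta 1 := hm.congr (hev.mono fun s hs => hs.symm)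
  exact (meromorphicOrderAt_eq_int_iff hz).mpr ⟨g, hg.analyticAt 1, hg1, hev⟩

theorem mainTheorem2 (α : ℝ) (hα0 : 0 < α) (hα : α < 1 / 2) :
    -- the operators belong to the trace ideals that the determinants require
    MemTraceIdeal 2 (gammaOp α) ∧ MemTraceIdeal 2 (xiOp α) ∧ MemTraceIdeal 1 (phiOp α) ∧
    -- the determinant formula
    (∀ s : ℂ, s ≠ 1 →
      riemannZeta s = -(Complex.exp (((Real.log (2 * Real.pi) - 1 : ℝ) : ℂ) * s) / 2) *
        (regDet 2 (-(s / 2) • gammaOp α) * regDet 2 (-s • xiOp α) / regDet 1 (-s • phiOp α))) ∧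
    -- the first factor gives the trivial zeros
    (Differentiable ℂ (fun s : ℂ => regDet 2 (-(s / 2) • gammaOp α)) ∧
      (∀ s : ℂ, regDet 2 (-(s / 2) • gammaOp α) = 0 ↔ ∃ n : ℕ, s = -2 * (n + 1)) ∧
      (∀ n : ℕ, analyticOrderAt (fun s : ℂ => regDet 2 (-(s / 2) • gammaOp α)) (-2 * (n + 1)) =
        analyticOrderAt riemannZeta (-2 * (n + 1)))) ∧
    -- the second factor gives the critical zeros
    (Differentiable ℂ (fun s : ℂ => regDet 2 (-s • xiOp α)) ∧
      (∀ s : ℂ, regDet 2 (-s • xiOp α) = 0 ↔ riemannZeta s = 0 ∧ 0 < s.re ∧ s.re < 1) ∧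
      (∀ s : ℂ, 0 < s.re → s.re < 1 →
        analyticOrderAt (fun s : ℂ => regDet 2 (-s • xiOp α)) s =
          analyticOrderAt riemannZeta s)) ∧
    -- the denominator gives the simple pole at 1, the only pole
    (Differentiable ℂ (fun s : ℂ => regDet 1 (-s • phiOp α)) ∧
      (∀ s : ℂ, regDet 1 (-s • phiOp α) = 0 ↔ s = 1) ∧
      analyticOrderAt (fun s : ℂ => regDet 1 (-s • phiOp α)) 1 = 1 ∧
      meromorphicOrderAt riemannZeta 1 = -1) := by
  have hΓ := summable_norm_invZeros_recipGamma_sq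
  have hξ := summable_norm_invZeros_xiFunction_sq
  obtain ⟨e, he⟩ := exists_equiv_zeroIndex_phiFunction
  have hfin : Finite (ZeroIndex phiFunction) := Finite.of_equiv _ e.symm
  have hφ : Summable fun i => ‖invZeros phiFunction i‖ := Summable.of_finite
  have e1 : ∀ s : ℂ, regDet 2 (-(s / 2) • gammaOp α)
      = canonicalProduct (invZeros recipGamma) (s / 2) := fun s =>
    regDet_two_entireOp hα0 _ _ hΓ (s / 2)
  have e2 : ∀ s : ℂ, regDet 2 (-s • xiOp α) = canonicalProduct (invZeros xiFunction) s := fun s =>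
    regDet_two_entireOp hα0 _ _ hξ s
  have e3 : ∀ s : ℂ, regDet 1 (-s • phiOp α) = 1 - s := fun s => by
    refine (regDet_one_entireOp hα0 _ _ hφ s).trans ?_
    rw [← e.symm.tprod_eq, tprod_fintype]
    have := he (e.symm ())
    rw [invZeros] at this
    simp [← this]
  simp only [e1, e2, e3]
  have d1 : Differentiable ℂ fun s => canonicalProduct (invZeros recipGamma) (s / 2) :=
    (differentiable_canonicalProduct hΓ).comp (differentiable_id.div_const 2)
  have d2 := differentiable_canonicalProduct hξ
  have d3 : Differentiable ℂ fun s : ℂ => 1 - s := differentiable_id.const_sub 1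
  have hexp : Differentiable ℂ fun s : ℂ =>
      -(Complex.exp (((Real.log (2 * Real.pi) - 1 : ℝ) : ℂ) * s) / 2) := by fun_prop
  have hne : ∀ s : ℂ, s ∈ ({1}ᶜ : Set ℂ) → 1 - s ≠ 0 := fun s hs =>
    sub_ne_zero.mpr (Ne.symm hs)
  have hexp0 : ∀ s : ℂ, -(Complex.exp (((Real.log (2 * Real.pi) - 1 : ℝ) : ℂ) * s) / 2) ≠ 0 :=
    fun s => neg_ne_zero.mpr (div_ne_zero (Complex.exp_ne_zero _) two_ne_zero)
  refine ⟨memTraceIdeal_entireOp hα0 _ _ two_ne_zero hΓ,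
    memTraceIdeal_entireOp hα0 _ _ two_ne_zero hξ,
    memTraceIdeal_entireOp hα0 _ _ one_ne_zero Summable.of_finite,
    fun s hs => riemannZeta_eq_canonicalProduct hs,
    ⟨d1, fun s => ?_, fun n => ?_⟩, ⟨d2, fun s => ?_, fun s h0 h1 => ?_⟩,
    d3, fun s => ?_, ?_, meromorphicOrderAt_riemannZeta_one⟩
  · rw [canonicalProduct_recipGamma_eq_zero_iff, recipGamma_half_eq_zero_iff]
  · have hre : (-2 * ((n : ℂ) + 1)).re = -2 * ((n : ℝ) + 1) := by simp
    have hn := n.cast_nonneg (α := ℝ)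
    have ha : -2 * ((n : ℂ) + 1) ≠ 1 := fun h => by
      rw [h, Complex.one_re] at hre
      linarith
    -- The cofactor contains the `ξ` product, which is nonzero at the trivial zeros because they lie
    -- in `Re s ≤ 0`.
    refine analyticOrderAt_riemannZeta_eq d1
      (u := fun s => -(Complex.exp (((Real.log (2 * Real.pi) - 1 : ℝ) : ℂ) * s) / 2) *
        canonicalProduct (invZeros xiFunction) s / (1 - s))
      ((hexp.mul d2).differentiableOn.fun_div d3.differentiableOn hne)
      (fun s hs => by rw [riemannZeta_eq_canonicalProduct hs]; ring) ha ?_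
    refine div_ne_zero (mul_ne_zero (hexp0 _) ?_) (hne _ ha)
    rw [Ne, canonicalProduct_xi_eq_zero_iff]
    exact xiFunction_ne_zero_of_re_nonpos (by rw [hre]; linarith)
  · rw [canonicalProduct_xi_eq_zero_iff, xiFunction_eq_zero_iff]
  · have ha : s ≠ 1 := by
      rintro rfl
      simp at h1
    -- The cofactor contains the Gamma product, which has no zeros in `Re s > 0`.
    refine analyticOrderAt_riemannZeta_eq d2
      (u := fun s => -(Complex.exp (((Real.log (2 * Real.pi) - 1 : ℝ) : ℂ) * s) / 2) *
        canonicalProduct (invZeros recipGamma) (s / 2) / (1 - s))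
      ((hexp.mul d1).differentiableOn.fun_div d3.differentiableOn hne)
      (fun s hs => by rw [riemannZeta_eq_canonicalProduct hs]; ring) ha ?_
    refine div_ne_zero (mul_ne_zero (hexp0 _) ?_) (hne _ ha)
    rw [Ne, canonicalProduct_recipGamma_eq_zero_iff]
    exact recipGamma_half_ne_zero_of_re_pos h0
  · rw [sub_eq_zero, eq_comm]
  · refine (d3.analyticAt 1).analyticOrderAt_eq_one_of_zero_deriv_ne_zero (sub_self 1) ?_
    simp
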